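/- Let $h\in\mathbb R$ and let $(g_n)_{n\ge1}$, $(\tilde g_n)_{n\ge1}$ be real sequences with $g_n,\tilde g_n=O(n^{-\varepsilon})$ for some $\varepsilon>0$. Put $$V(\varphi)=h+2\sum_{n\ge1}\Big[\frac{g_n}{n}\cos n\varphi+\frac{\tilde g_n}{n}\sin n\varphi\Big],$$ $$\mathcal Z_N(\beta)=\frac1{N!}\int_{[-\pi,\pi]^N}\prod_{1\le j<k\le N}|e^{i\varphi_j}-e^{i\varphi_k}|^2\,e^{\beta\sum_{j=1}^N V(\varphi_j)}\,\frac{d^N\varphi}{(2\pi)^N}.$$ For $-\pi<\varphi\le\pi$ let $S(\varphi)=\sum_{n\ge1}(g_n\cos n\varphi+\tilde g_n\sin n\varphi)\in[-\infty,\infty]$ be the limit of the partial sums (their lower limit, if there is no limit in $[-\infty,\infty]$), let $m=\inf_{-\pi<\varphi\le\pi}S(\varphi)$, and let $\gamma_c=[-2m]^{-1}\in[0,\infty]$, where $\gamma_c=\infty$ if $m\ge0$ and $\gamma_c=0$ if $m=-\infty$. Then: 1. For $\gamma\ge0$, one has $\gamma\le\gamma_c$ if and only if the full-support density $\frac1{2\pi}[1+2\gamma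 S(\varphi)]$ is nonnegative for all $-\pi<\varphi\le\pi$ (with $0\cdot(\pm\infty)=0$). 2. The series $\sum_{n\ge1}(g_n^2+\tilde g_n^2)/n$ converges, and for every $\gamma\ge0$ with $\gamma\le\gamma_c$ $$\lim_{N\to\infty}\frac{\log\mathcal Z_N(\gamma N)}{N^2}=\gamma h+\gamma^2\sum_{n\ge1}\frac{g_n^2+\tilde g_n^2}{n}.$$ 3. This is the value given by the strong Szegő theorem: if $c_k$ ($k\in\mathbb Z$) are the Fourier coefficients of $\log f=\beta V$, with $\beta=\gamma N$, then $\frac1{N^2}\big(Nc_0+\sum_{k\ge1}k\,c_kc_{-k}\big)=\gamma h+\gamma^2\sum_{n\ge1}(g_n^2+\tilde g_n^2)/n$ for every $N\ge1$ and every real $\gamma$. 4. In particular, for $0\le\gamma\le\gamma_c$ (with the $\gamma_c$ of the respective sequence), the limit is $\gamma h-\gamma^2\log(1-e^{-2\alpha})$ if $g_n=e^{-n\alpha}$, $\tilde g_n=0$ with $\alpha>0$, and it is $\gamma h+\gamma^2\sum_{n\ge1}e^{-2n\alpha}/n^{2p+1}$ if $g_n=e^{-n\alpha}/n^{p}$,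 $\tilde g_n=0$ with $p\in\mathbb Z$ and either $\alpha>0$, or $\alpha=0$ and $p>0$. -/

import Mathlib

open Filter Topology MeasureTheory

noncomputable section

/-- The potential `V(φ) = h + 2 ∑_{n ≥ 1} [(g_n / n) cos (n φ) + (g'_n / n) sin (n φ)]`.
The coefficients are indexed by `n ≥ 1`; the values `g 0` and `g' 0` are never used. -/
def potential (h : ℝ) (g g' : ℕ → ℝ) (φ : ℝ) : ℝ :=
  h + 2 * ∑' n : ℕ, (g (n + 1) / ((n : ℝ) + 1) * Real.cos (((n : ℝ) + 1) * φ)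
    + g' (n + 1) / ((n : ℝ) + 1) * Real.sin (((n : ℝ) + 1) * φ))

/-- The partition function
`Z(β) = (1 / N!) ∫_{[-π, π]^N} ∏_{j < k} |e^{i φ_j} - e^{i φ_k}|² e^{β ∑_j V(φ_j)} dφ / (2π)^N`. -/
def partitionFunction (N : ℕ) (V : ℝ → ℝ) (β : ℝ) : ℝ :=
  (1 / (N.factorial : ℝ)) *
    ∫ φ in Set.Icc (fun _ : Fin N => -Real.pi) (fun _ : Fin N => Real.pi),
      (∏ j : Fin N, ∏ k ∈ Finset.Ioi j,
          ‖Complex.exp (Complex.I * (φ j : ℂ)) - Complex.exp (Complex.I * (φ k : ℂ))‖ ^ 2)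
        * Real.exp (β * ∑ j : Fin N, V (φ j)) * (1 / (2 * Real.pi)) ^ N

/-- The free energy `log Z(β) / N²` at `β = γ N`. -/
def freeEnergy (N : ℕ) (V : ℝ → ℝ) (γ : ℝ) : ℝ :=
  Real.log (partitionFunction N V (γ * N)) / (N : ℝ) ^ 2

/-- The coefficients `g_n`, `g'_n` are `O(n^{-ε})` for some `ε > 0`, that is, the Fourier
coefficients of the potential are `O(n^{-1-ε})`. -/
def CoeffDecay (g g' : ℕ → ℝ) : Prop :=
  ∃ ε : ℝ, 0 < ε ∧
    (g =O[atTop] fun n : ℕ => (n : ℝ) ^ (-ε)) ∧ (g' =O[atTop] fun n : ℕ => (n : ℝ) ^ (-ε))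

/-- The sum `∑_{n ≥ 1} (g_n cos (n φ) + g'_n sin (n φ))` as an extended real number: the limit
of the partial sums wherever they have a limit in `[-∞, ∞]` (it may be conditional, or infinite),
and their lower limit otherwise. -/
def trigSum (g g' : ℕ → ℝ) (φ : ℝ) : EReal :=
  liminf (fun K : ℕ => ((∑ n ∈ Finset.Icc 1 K,
    (g n * Real.cos (n * φ) + g' n * Real.sin (n * φ)) : ℝ) : EReal)) atTop

/-- The full-support density `(1 / 2π) [1 + 2 γ ∑_{n ≥ 1} (g_n cos (n φ) + g'_n sin (n φ))]`. -/
def fullDensity (g g' : ℕ → ℝ) (γ φ : ℝ) : EReal :=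
  ((1 / (2 * Real.pi) : ℝ) : EReal) * (1 + ((2 * γ : ℝ) : EReal) * trigSum g g' φ)

/-- The critical coupling `γ_c = [-2 min_φ ∑_{n ≥ 1} (g_n cos (n φ) + g'_n sin (n φ))]⁻¹`, as an
element of `[0, ∞]`: it is `∞` if the minimum is not negative (no upper bound on the coupling), and
`0` if the sum is unbounded below. -/
def criticalCoupling (g g' : ℕ → ℝ) : ENNReal :=
  (((-2 : ℝ) : EReal) * ⨅ φ ∈ Set.Ioc (-Real.pi) Real.pi, trigSum g g' φ).toENNReal⁻¹

/-- The `k`-th Fourier coefficient of the logarithm of the symbol, `log f = β V`. -/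
def logSymbolCoeff (V : ℝ → ℝ) (β : ℝ) (k : ℤ) : ℂ :=
  (1 / (2 * Real.pi) : ℂ) * ∫ φ in (-Real.pi)..Real.pi,
    ((β * V φ : ℝ) : ℂ) * Complex.exp (-(Complex.I * (k : ℂ) * (φ : ℂ)))

/-- The exponent `N c_0 + ∑_{k ≥ 1} k c_k c_{-k}` of the strong Szegő limit theorem for the
`N × N` Toeplitz determinant with symbol `f = e^{β V}`, where `c_k` are the Fourier coefficients
of `log f`. -/
def szegoExponent (N : ℕ) (V : ℝ → ℝ) (β : ℝ) : ℂ :=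
  (N : ℂ) * logSymbolCoeff V β 0 +
    ∑' k : ℕ, ((k : ℂ) + 1) * logSymbolCoeff V β ((k : ℤ) + 1) * logSymbolCoeff V β (-((k : ℤ) + 1))

end

/-! The free energy is the maximum of a quadratic functional. Let p_n, q_n be the cosine and sine
moments of the empirical measure of the angles. Since -log|1 - e^{iθ}|² = 2 ∑ cos(nθ)/n, the
exponent divided by N² is, to leading order, γh + ∑ [2γ(g_n p_n + g'_n q_n) - (p_n² + q_n²)]/n.
Completing the square bounds it by γh + γ² ∑ (g_n² + g'_n²)/n, with equality at p_n = γ g_n, q_n = γ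
g'_n. These are formally the moments of the full-support density, so the bound should be sharp when
that density is nonnegative.

The upper bound, `SummableCoeff.partitionFunction_le`, needs no critical coupling: |e^{ia} -
e^{ib}|² is replaced by a multiple of |e^{ia} - r e^{ib}|² with r < 1, the series are truncated
uniformly, and the square is completed pointwise.

The lower bound, `exp_le_partitionFunction`, is Jensen's inequality for a product of N copies of a
continuous positive trial density; entropy and N! cost only O(N log N). The full-support density may
be neither continuous nor integrable a priori, so its moments are multiplied by (1-τ)/(1+τ²n²), and
τ tends to 0 at the end.

The delicate point is that the smoothed density is positive, because the hypothesis only bounds the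
lower limit of the partial sums at each point, with no uniformity. `neg_le_resolventMean` settles it
by Riemann's method: the series is integrated twice to a continuous F, the means are Laplace
transforms of second differences of F, and a second difference that is too large would produce a
single point at which the pointwise hypothesis is contradicted. -/

/-- The `n`-th term of a trigonometric series. -/
noncomputable def trigTerm (a b : ℕ → ℝ) (n : ℕ) (x : ℝ) : ℝ :=
  a n * Real.cos (n * x) + b n * Real.sin (n * x)

lemma abs_trigTerm_le (a b : ℕ → ℝ) (n : ℕ) (x : ℝ) : |trigTerm a b n x| ≤ |a n| + |b n| := by
  unfold trigTerm
  refine (abs_add_le _ _).trans (add_le_add ?_ ?_) <;> rw [abs_mul]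
  · exact mul_le_of_le_one_right (abs_nonneg _) (Real.abs_cos_le_one _)
  · exact mul_le_of_le_one_right (abs_nonneg _) (Real.abs_sin_le_one _)

lemma trigTerm_second_difference (a b : ℕ → ℝ) (n : ℕ) (x y : ℝ) :
    trigTerm a b n (x + y) + trigTerm a b n (x - y) - 2 * trigTerm a b n x
      = 2 * (Real.cos (n * y) - 1) * trigTerm a b n x := by
  unfold trigTerm
  rw [mul_add, mul_sub, Real.cos_add, Real.cos_sub, Real.sin_add, Real.sin_sub]
  ring

@[fun_prop]
lemma continuous_trigTerm (a b : ℕ → ℝ) (n : ℕ) : Continuous (trigTerm a b n) := by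
  unfold trigTerm; fun_prop

/-! ### Laplace integrals and summation by parts. -/

lemma integral_exp_neg_mul_pow (k : ℕ) :
    IntegrableOn (fun s : ℝ => Real.exp (-s) * s ^ k) (Set.Ioi 0) ∧
    ∫ s in Set.Ioi (0 : ℝ), Real.exp (-s) * s ^ k = k.factorial := by
  have hk : (0 : ℝ) < (k : ℝ) + 1 := by positivity
  have h1 := Real.GammaIntegral_convergent hk
  have h2 := Real.Gamma_eq_integral hk
  simp only [add_sub_cancel_right, Real.rpow_natCast] at h1 h2
  exact ⟨h1, by rw [← h2, Real.Gamma_nat_eq_factorial]⟩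

/-- This is the source of the multipliers 1/(1+σ²n²): averaging cos(nσs) over an exponential
variable s produces them. -/
lemma integral_exp_neg_mul_cos (a : ℝ) :
    IntegrableOn (fun s : ℝ => Real.exp (-s) * Real.cos (a * s)) (Set.Ioi 0) ∧
    ∫ s in Set.Ioi (0 : ℝ), Real.exp (-s) * Real.cos (a * s) = 1 / (1 + a ^ 2) := by
  have hre : (-1 + a * Complex.I : ℂ).re < 0 := by simp
  have hi := integrableOn_exp_mul_complex_Ioi hre 0
  have h := integral_exp_mul_complex_Ioi hre 0
  have hfun : ∀ s : ℝ, (Complex.exp ((-1 + a * Complex.I) * s)).re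
      = Real.exp (-s) * Real.cos (a * s) := by
    intro s
    rw [Complex.exp_re]
    simp
  have hi' : IntegrableOn (fun s : ℝ => (Complex.exp ((-1 + a * Complex.I) * s)).re)
    (Set.Ioi 0) := hi.re
  have h3 : ∫ s in Set.Ioi (0 : ℝ), (Complex.exp ((-1 + a * Complex.I) * s)).re
      = (∫ s in Set.Ioi (0 : ℝ), Complex.exp ((-1 + a * Complex.I) * s)).re := integral_re hi
  simp only [hfun] at hi' h3
  refine ⟨hi', ?_⟩
  rw [h3, h]
  simp only [Complex.ofReal_zero, mul_zero, Complex.exp_zero, Complex.div_re, Complex.normSq_apply]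
  simp
  field_simp

/-- The Laplace transform of the second differences of `∑ c n / (n + 1) ^ 2 * cos ((n + 1) x)`. -/
lemma integral_exp_neg_mul_second_difference {c : ℕ → ℝ} {B : ℝ} (hc : ∀ n, |c n| ≤ B) (σ : ℝ) :
    ∫ s in Set.Ioi (0 : ℝ), ∑' n : ℕ, Real.exp (-s) *
        (2 * (Real.cos (((n : ℝ) + 1) * (σ * s)) - 1) * (c n / ((n : ℝ) + 1) ^ 2))
      = -2 * σ ^ 2 * ∑' n : ℕ, 1 / (1 + (σ * ((n : ℝ) + 1)) ^ 2) * c n := by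
  have hE := integral_exp_neg_mul_pow 0
  simp only [pow_zero, mul_one, Nat.factorial_zero, Nat.cast_one] at hE
  have hterm : ∀ n : ℕ, (fun s : ℝ => Real.exp (-s) *
        (2 * (Real.cos (((n : ℝ) + 1) * (σ * s)) - 1) * (c n / ((n : ℝ) + 1) ^ 2)))
      = fun s => (2 * (c n / ((n : ℝ) + 1) ^ 2)) *
        (Real.exp (-s) * Real.cos ((((n : ℝ) + 1) * σ) * s) - Real.exp (-s)) := by
    intro n; funext s; rw [← mul_assoc ((n : ℝ) + 1) σ s]; ring
  have hint : ∀ n : ℕ, IntegrableOn (fun s : ℝ => Real.exp (-s) *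
        (2 * (Real.cos (((n : ℝ) + 1) * (σ * s)) - 1) * (c n / ((n : ℝ) + 1) ^ 2))) (Set.Ioi 0) := by
    intro n
    rw [hterm]
    exact ((integral_exp_neg_mul_cos _).1.sub hE.1).const_mul _
  have hB : 0 ≤ B := (abs_nonneg _).trans (hc 0)
  have hsum2 : Summable (fun n : ℕ => 1 / ((n : ℝ) + 1) ^ 2) := by
    have := (summable_nat_add_iff 1).2 (Real.summable_one_div_nat_pow.2 (by norm_num : 1 < 2))
    simpa using this
  have hS : Summable fun n : ℕ => ∫ s in Set.Ioi (0 : ℝ), ‖Real.exp (-s) *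
        (2 * (Real.cos (((n : ℝ) + 1) * (σ * s)) - 1) * (c n / ((n : ℝ) + 1) ^ 2))‖ := by
    refine Summable.of_nonneg_of_le (fun n => integral_nonneg fun s => norm_nonneg _) (fun n => ?_)
      (hsum2.mul_left (4 * B))
    have hle : ∀ s : ℝ, ‖Real.exp (-s) *
        (2 * (Real.cos (((n : ℝ) + 1) * (σ * s)) - 1) * (c n / ((n : ℝ) + 1) ^ 2))‖
        ≤ Real.exp (-s) * (4 * (B / ((n : ℝ) + 1) ^ 2)) := by
      intro s
      rw [norm_mul, Real.norm_of_nonneg (Real.exp_pos _).le, norm_mul, Real.norm_eq_abs,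
        Real.norm_eq_abs, abs_div, abs_of_pos (by positivity : (0 : ℝ) < ((n : ℝ) + 1) ^ 2)]
      have h4 : |2 * (Real.cos (((n : ℝ) + 1) * (σ * s)) - 1)| ≤ 4 := by
        rw [abs_le]
        constructor <;> nlinarith [Real.neg_one_le_cos (((n : ℝ) + 1) * (σ * s)),
          Real.cos_le_one (((n : ℝ) + 1) * (σ * s))]
      gcongr
      exact hc n
    refine (integral_mono_of_nonneg (Eventually.of_forall fun s => norm_nonneg _)
      (hE.1.mul_const _) (Eventually.of_forall hle)).trans (le_of_eq ?_)
    rw [integral_mul_const, hE.2]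
    ring
  rw [← (hasSum_integral_of_summable_integral_norm hint hS).tsum_eq, ← tsum_mul_left]
  congr 1; funext n
  rw [hterm, integral_const_mul, integral_sub (integral_exp_neg_mul_cos _).1 hE.1,
    (integral_exp_neg_mul_cos _).2, hE.2]
  have h1 : (0 : ℝ) < 1 + (((n : ℝ) + 1) * σ) ^ 2 := by positivity
  have h2 : (0 : ℝ) < 1 + (σ * ((n : ℝ) + 1)) ^ 2 := by positivity
  field_simp
  ring

/-- Means of a sequence of partial sums, with decreasing weights, inherit an eventual lower
bound. -/
lemma sum_mul_ge_of_partial_sums_ge {a φ : ℕ → ℝ} {c B : ℝ} {n₀ : ℕ} (hφ : Antitone φ)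
    (hφ0 : ∀ n, 0 ≤ φ n) (h1 : ∀ n, -c - B ≤ ∑ i ∈ Finset.range (n + 1), a i)
    (h2 : ∀ n, n₀ ≤ n → -c ≤ ∑ i ∈ Finset.range (n + 1), a i) {M : ℕ} (hM : n₀ ≤ M) :
    -c * φ 0 - B * (φ 0 - φ n₀) ≤ ∑ i ∈ Finset.range (M + 1), φ i * a i := by
  -- Abel summation as an induction. The defect `B` is charged only for the decrease of the weights
  -- up to `n₀`, hence the `min`.
  have key : ∀ m : ℕ, -c * (φ 0 - φ m) - B * (φ 0 - φ (min m n₀)) ≤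
      ∑ i ∈ Finset.range (m + 1), φ i * a i - φ m * ∑ i ∈ Finset.range (m + 1), a i := by
    intro m
    induction m with
    | zero => simp
    | succ m ih =>
      rw [Finset.sum_range_succ _ (m + 1), Finset.sum_range_succ a (m + 1)]
      have hd : 0 ≤ φ m - φ (m + 1) := sub_nonneg.2 (hφ m.le_succ)
      rcases le_or_gt n₀ m with hm | hm
      · rw [min_eq_right hm] at ih
        rw [min_eq_right (hm.trans m.le_succ)]
        nlinarith [mul_le_mul_of_nonneg_left (h2 m hm) hd]
      · rw [min_eq_left hm.le] at ih
        rw [min_eq_left hm]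
        nlinarith [mul_le_mul_of_nonneg_left (h1 m) hd]
  have := key M
  rw [min_eq_right hM] at this
  nlinarith [mul_le_mul_of_nonneg_left (h2 M hM) (hφ0 M)]

/-! ### Positivity of the means by Riemann's method of second differences. -/

section Positivity

variable {g g' : ℕ → ℝ} {B : ℝ}

lemma summable_trigTerm_div_sq (hg : ∀ n, |g (n + 1)| ≤ B) (hg' : ∀ n, |g' (n + 1)| ≤ B) :
    Summable (fun n : ℕ => 2 * B * (1 / ((n : ℝ) + 1) ^ 2)) ∧
    (∀ (x : ℝ) (n : ℕ), |trigTerm g g' (n + 1) x / ((n : ℝ) + 1) ^ 2|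
      ≤ 2 * B * (1 / ((n : ℝ) + 1) ^ 2)) := by
  have hsum2 : Summable (fun n : ℕ => 1 / ((n : ℝ) + 1) ^ 2) := by
    have := (summable_nat_add_iff 1).2 (Real.summable_one_div_nat_pow.2 (by norm_num : 1 < 2))
    simpa using this
  refine ⟨hsum2.mul_left _, fun x n => ?_⟩
  rw [abs_div, abs_of_pos (by positivity : (0 : ℝ) < ((n : ℝ) + 1) ^ 2), mul_one_div]
  gcongr
  exact (abs_trigTerm_le _ _ _ _).trans (by linarith [hg n, hg' n])

/-- The series integrated twice. -/
noncomputable def twiceIntegrated (g g' : ℕ → ℝ) (x : ℝ) : ℝ :=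
  ∑' n : ℕ, trigTerm g g' (n + 1) x / ((n : ℝ) + 1) ^ 2

/-- Means of the series with the multipliers `1 / (1 + (σ n) ^ 2)`. -/
noncomputable def resolventMean (g g' : ℕ → ℝ) (σ x : ℝ) : ℝ :=
  ∑' n : ℕ, 1 / (1 + (σ * ((n : ℝ) + 1)) ^ 2) * trigTerm g g' (n + 1) x

lemma summable_resolvent {σ : ℝ} (hσ : 0 < σ) :
    Summable (fun n : ℕ => 1 / (1 + (σ * ((n : ℝ) + 1)) ^ 2)) := by
  have hsum2 : Summable (fun n : ℕ => 1 / ((n : ℝ) + 1) ^ 2) := by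
    have := (summable_nat_add_iff 1).2 (Real.summable_one_div_nat_pow.2 (by norm_num : 1 < 2))
    simpa using this
  refine Summable.of_nonneg_of_le (fun n => by positivity) (fun n => ?_)
    (hsum2.mul_left (1 / σ ^ 2))
  rw [one_div_mul_one_div, mul_pow]
  gcongr
  linarith

lemma summable_resolventMean (hg : ∀ n, |g (n + 1)| ≤ B) (hg' : ∀ n, |g' (n + 1)| ≤ B) {σ : ℝ}
    (hσ : 0 < σ) (x : ℝ) :
    Summable (fun n : ℕ => 1 / (1 + (σ * ((n : ℝ) + 1)) ^ 2) * trigTerm g g' (n + 1) x) := by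
  refine Summable.of_norm_bounded ((summable_resolvent hσ).mul_right (2 * B)) fun n => ?_
  rw [norm_mul, Real.norm_of_nonneg (by positivity)]
  gcongr
  exact (abs_trigTerm_le _ _ _ _).trans (by linarith [hg n, hg' n])

lemma continuous_twiceIntegrated (hg : ∀ n, |g (n + 1)| ≤ B) (hg' : ∀ n, |g' (n + 1)| ≤ B) :
    Continuous (twiceIntegrated g g') := by
  obtain ⟨h1, h2⟩ := summable_trigTerm_div_sq hg hg'
  exact continuous_tsum (fun n => by fun_prop) h1 fun n x => h2 x n

lemma abs_twiceIntegrated_le (hg : ∀ n, |g (n + 1)| ≤ B) (hg' : ∀ n, |g' (n + 1)| ≤ B) :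
    ∃ D, ∀ x, |twiceIntegrated g g' x| ≤ D := by
  obtain ⟨h1, h2⟩ := summable_trigTerm_div_sq hg hg'
  exact ⟨_, fun x => tsum_of_norm_bounded (f := fun n : ℕ => trigTerm g g' (n + 1) x / ((n : ℝ) + 1) ^ 2)
    h1.hasSum (h2 x)⟩

lemma twiceIntegrated_second_difference (hg : ∀ n, |g (n + 1)| ≤ B)
    (hg' : ∀ n, |g' (n + 1)| ≤ B) (x y : ℝ) :
    twiceIntegrated g g' (x + y) + twiceIntegrated g g' (x - y) - 2 * twiceIntegrated g g' x
      = ∑' n : ℕ, 2 * (Real.cos (((n : ℝ) + 1) * y) - 1) *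
          (trigTerm g g' (n + 1) x / ((n : ℝ) + 1) ^ 2) := by
  obtain ⟨h1, h2⟩ := summable_trigTerm_div_sq hg hg'
  have hs : ∀ x, Summable fun n : ℕ => trigTerm g g' (n + 1) x / ((n : ℝ) + 1) ^ 2 :=
    fun x => Summable.of_norm_bounded h1 (h2 x)
  unfold twiceIntegrated
  rw [← (hs (x + y)).tsum_add (hs (x - y)), ← tsum_mul_left,
    ← ((hs (x + y)).add (hs (x - y))).tsum_sub ((hs x).mul_left 2)]
  congr 1; funext n
  have := trigTerm_second_difference g g' (n + 1) x y
  push_cast at this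
  rw [← mul_div_assoc (2 * (Real.cos (((n : ℝ) + 1) * y) - 1)), ← this]
  ring

/-- Formally F'' is minus the series, so averaging second differences of F at scale σ gives -2σ²
times a mean of the series. This turns bounds on second differences into bounds on means. -/
lemma integral_second_difference_twiceIntegrated (hg : ∀ n, |g (n + 1)| ≤ B)
    (hg' : ∀ n, |g' (n + 1)| ≤ B) (σ x : ℝ) :
    ∫ s in Set.Ioi (0 : ℝ), Real.exp (-s) * (twiceIntegrated g g' (x + σ * s)
        + twiceIntegrated g g' (x - σ * s) - 2 * twiceIntegrated g g' x)
      = -2 * σ ^ 2 * resolventMean g g' σ x := by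
  unfold resolventMean
  rw [← integral_exp_neg_mul_second_difference (B := 2 * B) (fun n =>
    (abs_trigTerm_le _ _ _ _).trans (by linarith [hg n, hg' n]))]
  congr 1; funext s
  rw [twiceIntegrated_second_difference hg hg', tsum_mul_left]

lemma integrableOn_second_difference (hg : ∀ n, |g (n + 1)| ≤ B)
    (hg' : ∀ n, |g' (n + 1)| ≤ B) (σ x : ℝ) :
    IntegrableOn (fun s => Real.exp (-s) * (twiceIntegrated g g' (x + σ * s)
        + twiceIntegrated g g' (x - σ * s) - 2 * twiceIntegrated g g' x)) (Set.Ioi 0) := by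
  have hE := (integral_exp_neg_mul_pow 0).1
  simp only [pow_zero, mul_one] at hE
  obtain ⟨D, hD⟩ := abs_twiceIntegrated_le hg hg'
  have hcont := continuous_twiceIntegrated hg hg'
  refine hE.mul_bdd (c := 4 * D) ?_ (Eventually.of_forall fun s => ?_)
  · exact Continuous.aestronglyMeasurable (by fun_prop)
  · have h1 := abs_le.1 (hD (x + σ * s))
    have h2 := abs_le.1 (hD (x - σ * s))
    have h3 := abs_le.1 (hD x)
    rw [Real.norm_eq_abs, abs_le]
    constructor <;> linarith

/-- If the lower limit of the partial sums is at least `-c` at `x`, so is that of the means. -/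
lemma resolventMean_ge_of_partial_sums (hg : ∀ n, |g (n + 1)| ≤ B) (hg' : ∀ n, |g' (n + 1)| ≤ B)
    {x c : ℝ} (hc : 0 ≤ c)
    (h : ∀ᶠ K : ℕ in atTop, -c ≤ ∑ n ∈ Finset.Icc 1 K, trigTerm g g' n x) :
    ∃ E : ℝ, ∀ σ, 0 < σ → -c - E * σ ^ 2 ≤ resolventMean g g' σ x := by
  obtain ⟨n₀, hn₀⟩ := eventually_atTop.1 h
  have hIcc : ∀ K : ℕ, ∑ n ∈ Finset.Icc 1 K, trigTerm g g' n x
      = ∑ n ∈ Finset.range K, trigTerm g g' (n + 1) x := by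
    intro K
    rw [Finset.range_eq_Ico, Finset.sum_Ico_add' (fun n => trigTerm g g' n x) 0 K 1]
    rfl
  have h2 : ∀ n, n₀ ≤ n → -c ≤ ∑ i ∈ Finset.range (n + 1), trigTerm g g' (i + 1) x :=
    fun n hn => (hIcc (n + 1)) ▸ hn₀ (n + 1) (by omega)
  have hA : ∀ n, |trigTerm g g' (n + 1) x| ≤ 2 * B := fun n =>
    (abs_trigTerm_le _ _ _ _).trans (by linarith [hg n, hg' n])
  have hB : 0 ≤ B := (abs_nonneg _).trans (hg 0)
  set C : ℝ := (n₀ + 1) * (2 * B) with hC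
  have hC0 : 0 ≤ C := by positivity
  have h1 : ∀ n, -c - C ≤ ∑ i ∈ Finset.range (n + 1), trigTerm g g' (i + 1) x := by
    intro n
    rcases le_or_gt n₀ n with hn | hn
    · linarith [h2 n hn]
    · have : |∑ i ∈ Finset.range (n + 1), trigTerm g g' (i + 1) x| ≤ (n + 1 : ℕ) * (2 * B) := by
        refine (Finset.abs_sum_le_sum_abs _ _).trans
          ((Finset.sum_le_sum fun i _ => hA i).trans ?_)
        simp
      have h3 : ((n + 1 : ℕ) : ℝ) * (2 * B) ≤ C := by
        rw [hC]; gcongr; exact_mod_cast (by omega : n + 1 ≤ n₀ + 1)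
      linarith [(abs_le.1 this).1]
  -- The weight drops by at most (σ(n₀+1))² up to index `n₀`, because 1 - 1/(1+u) ≤ u; `C` bounds
  -- the defect of the early partial sums.
  refine ⟨C * (n₀ + 1) ^ 2, fun σ hσ => ?_⟩
  have hanti : Antitone fun n : ℕ => 1 / (1 + (σ * ((n : ℝ) + 1)) ^ 2) := by
    intro m n hmn
    have : (m : ℝ) ≤ n := by exact_mod_cast hmn
    dsimp only
    gcongr
  have htend := (summable_resolventMean hg hg' hσ x).hasSum.tendsto_sum_nat
  refine ge_of_tendsto (htend.comp (tendsto_add_atTop_nat 1)) ?_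
  filter_upwards [eventually_ge_atTop n₀] with M hM
  refine le_trans ?_ (sum_mul_ge_of_partial_sums_ge hanti (fun n => by positivity) h1 h2 hM)
  have e1 : 1 / (1 + (σ * (((0 : ℕ) : ℝ) + 1)) ^ 2) ≤ 1 := by
    rw [div_le_one (by positivity)]; nlinarith [sq_nonneg σ]
  have e2 : 1 - (σ * ((n₀ : ℝ) + 1)) ^ 2 ≤ 1 / (1 + (σ * ((n₀ : ℝ) + 1)) ^ 2) := by
    rw [le_div_iff₀ (by positivity)]
    nlinarith [sq_nonneg ((σ * ((n₀ : ℝ) + 1)) ^ 2)]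
  nlinarith [mul_le_mul_of_nonneg_left e1 hc, mul_le_mul_of_nonneg_left e1 hC0,
    mul_le_mul_of_nonneg_left e2 hC0]

/-- Rajchman's inequality: a lower bound for the second differences at `x` gives an upper
bound for the means at `x`. -/
lemma resolventMean_le_of_second_difference (hg : ∀ n, |g (n + 1)| ≤ B)
    (hg' : ∀ n, |g' (n + 1)| ≤ B) {x c C : ℝ}
    (h : ∀ y, 0 ≤ y → c * y ^ 2 - C * y ^ 4 ≤ twiceIntegrated g g' (x + y)
        + twiceIntegrated g g' (x - y) - 2 * twiceIntegrated g g' x) {σ : ℝ} (hσ : 0 < σ) :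
    resolventMean g g' σ x ≤ -c + 12 * C * σ ^ 2 := by
  have h2 := integral_exp_neg_mul_pow 2
  have h4 := integral_exp_neg_mul_pow 4
  have hle : ∫ s in Set.Ioi (0 : ℝ), (c * σ ^ 2 * (Real.exp (-s) * s ^ 2)
      - C * σ ^ 4 * (Real.exp (-s) * s ^ 4)) ≤
      ∫ s in Set.Ioi (0 : ℝ), Real.exp (-s) * (twiceIntegrated g g' (x + σ * s)
        + twiceIntegrated g g' (x - σ * s) - 2 * twiceIntegrated g g' x) := by
    refine setIntegral_mono_on ((h2.1.const_mul _).sub (h4.1.const_mul _))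
      (integrableOn_second_difference hg hg' σ x) measurableSet_Ioi fun s hs => ?_
    have := mul_le_mul_of_nonneg_left (h (σ * s) (mul_nonneg hσ.le (le_of_lt hs)))
      (Real.exp_pos (-s)).le
    refine le_trans (le_of_eq ?_) this
    ring
  rw [integral_second_difference_twiceIntegrated hg hg',
    integral_sub (h2.1.const_mul _) (h4.1.const_mul _), integral_const_mul, integral_const_mul,
    h2.2, h4.2] at hle
  -- The moments 2! and 4! give 2cσ² - 24Cσ⁴; division by 2σ² leaves the constant 12.
  norm_num [Nat.factorial] at hle
  have hσ2 : 0 < 2 * σ ^ 2 := by positivity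
  refine le_of_mul_le_mul_left ?_ hσ2
  nlinarith

lemma resolventMean_ge_of_second_difference (hg : ∀ n, |g (n + 1)| ≤ B)
    (hg' : ∀ n, |g' (n + 1)| ≤ B) {x c : ℝ}
    (h : ∀ y, 0 ≤ y → twiceIntegrated g g' (x + y)
        + twiceIntegrated g g' (x - y) - 2 * twiceIntegrated g g' x ≤ c * y ^ 2) {σ : ℝ}
    (hσ : 0 < σ) : -c ≤ resolventMean g g' σ x := by
  have h2 := integral_exp_neg_mul_pow 2
  have hle : ∫ s in Set.Ioi (0 : ℝ), Real.exp (-s) * (twiceIntegrated g g' (x + σ * s)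
        + twiceIntegrated g g' (x - σ * s) - 2 * twiceIntegrated g g' x) ≤
      ∫ s in Set.Ioi (0 : ℝ), c * σ ^ 2 * (Real.exp (-s) * s ^ 2) := by
    refine setIntegral_mono_on (integrableOn_second_difference hg hg' σ x)
      (h2.1.const_mul _) measurableSet_Ioi fun s hs => ?_
    have := mul_le_mul_of_nonneg_left (h (σ * s) (mul_nonneg hσ.le (le_of_lt hs)))
      (Real.exp_pos (-s)).le
    refine le_trans this (le_of_eq ?_)
    ring
  rw [integral_second_difference_twiceIntegrated hg hg', integral_const_mul, h2.2] at hle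
  norm_num [Nat.factorial] at hle
  have hσ2 : 0 < 2 * σ ^ 2 := by positivity
  refine le_of_mul_le_mul_left ?_ hσ2
  nlinarith

/-- A continuous function with a second difference above `c y ^ 2` somewhere has all small second
differences at some point above `c y ^ 2`. -/
lemma exists_small_second_difference_ge {W : ℝ → ℝ} (hW : Continuous W) {x₁ t c : ℝ} (ht : 0 < t)
    (h : c * t ^ 2 < W (x₁ + t) + W (x₁ - t) - 2 * W x₁) :
    ∃ x₀ δ, 0 < δ ∧ ∀ y, 0 ≤ y → y ≤ δ → c * y ^ 2 ≤ W (x₀ + y) + W (x₀ - y) - 2 * W x₀ := by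
  -- Subtracting the chord slope and a parabola of second derivative c makes `Q` equal at both
  -- endpoints and strictly smaller at the centre. Its minimum is therefore interior, and second
  -- differences of `Q` at a minimum are nonnegative.
  set m : ℝ := (W (x₁ + t) - W (x₁ - t)) / (2 * t) with hm
  set Q : ℝ → ℝ := fun x => W x - c * (x - x₁) ^ 2 / 2 - m * (x - x₁) with hQ
  have hQc : Continuous Q := by fun_prop
  have hmt : m * t = (W (x₁ + t) - W (x₁ - t)) / 2 := by rw [hm]; field_simp
  have e1 : Q (x₁ + t) = (W (x₁ + t) + W (x₁ - t)) / 2 - c * t ^ 2 / 2 := by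
    simp only [hQ, add_sub_cancel_left, hmt]; ring
  have e2 : Q (x₁ - t) = (W (x₁ + t) + W (x₁ - t)) / 2 - c * t ^ 2 / 2 := by
    simp only [hQ, sub_sub_cancel_left, mul_neg, hmt]; ring
  have e3 : Q x₁ = W x₁ := by simp [hQ]
  obtain ⟨x₀, hx₀, hmin⟩ := isCompact_Icc.exists_isMinOn
    (Set.nonempty_Icc.2 (by linarith : x₁ - t ≤ x₁ + t)) hQc.continuousOn
  have h1 : Q x₀ ≤ Q x₁ := hmin ⟨by linarith, by linarith⟩
  have hl : x₁ - t < x₀ := lt_of_le_of_ne hx₀.1 (by rintro rfl; linarith)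
  have hr : x₀ < x₁ + t := lt_of_le_of_ne hx₀.2 (by rintro rfl; linarith)
  refine ⟨x₀, min (x₀ - (x₁ - t)) (x₁ + t - x₀), lt_min (by linarith) (by linarith),
    fun y hy hyδ => ?_⟩
  have hy1 := hyδ.trans (min_le_left _ _)
  have hy2 := hyδ.trans (min_le_right _ _)
  have m1 : Q x₀ ≤ Q (x₀ + y) := hmin ⟨by linarith, by linarith⟩
  have m2 : Q x₀ ≤ Q (x₀ - y) := hmin ⟨by linarith, by linarith⟩
  simp only [hQ] at m1 m2
  nlinarith

/-- If the partial sums of a trigonometric series with bounded coefficients have lower limit at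
least `-c` at every point, then all means of the series are at least `-c`. -/
theorem neg_le_resolventMean (hg : ∀ n, |g (n + 1)| ≤ B) (hg' : ∀ n, |g' (n + 1)| ≤ B)
    {c : ℝ} (hc : 0 ≤ c)
    (h : ∀ x, ∀ d, c < d → ∀ᶠ K : ℕ in atTop, -d ≤ ∑ n ∈ Finset.Icc 1 K, trigTerm g g' n x)
    {σ : ℝ} (hσ : 0 < σ) (x : ℝ) : -c ≤ resolventMean g g' σ x := by
  refine resolventMean_ge_of_second_difference hg hg' (fun t ht => ?_) hσ
  by_contra! hlt
  have ht0 : 0 < t := by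
    rcases ht.eq_or_lt with rfl | h
    · simp at hlt
      linarith
    · exact h
  -- The gap between c and c' leaves room for the strict inequality in `h` and for the final
  -- contradiction.
  obtain ⟨c', hc1, hc2⟩ := exists_between ((lt_div_iff₀ (by positivity : 0 < t ^ 2)).2 hlt)
  rw [lt_div_iff₀ (by positivity)] at hc2
  obtain ⟨x₀, δ, hδ, hx₀⟩ := exists_small_second_difference_ge
    (continuous_twiceIntegrated hg hg') ht0 hc2
  obtain ⟨D, hD⟩ := abs_twiceIntegrated_le hg hg'
  have hD0 : 0 ≤ D := (abs_nonneg _).trans (hD 0)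
  have hc'0 : 0 ≤ c' := hc.trans hc1.le
  -- For y > δ only |F| ≤ D is known; this quartic correction absorbs both 4D and c'y² there.
  set C : ℝ := 4 * D / δ ^ 4 + c' / δ ^ 2 with hC
  have hC0 : 0 ≤ C := by positivity
  have hall : ∀ y, 0 ≤ y → c' * y ^ 2 - C * y ^ 4 ≤ twiceIntegrated g g' (x₀ + y)
        + twiceIntegrated g g' (x₀ - y) - 2 * twiceIntegrated g g' x₀ := by
    intro y hy
    rcases le_or_gt y δ with hyδ | hyδ
    · have : 0 ≤ C * y ^ 4 := by positivity
      linarith [hx₀ y hy hyδ]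
    · have h1 := abs_le.1 (hD (x₀ + y))
      have h2 := abs_le.1 (hD (x₀ - y))
      have h3 := abs_le.1 (hD x₀)
      have e1 : 4 * D ≤ 4 * D / δ ^ 4 * y ^ 4 := by
        rw [div_mul_eq_mul_div, le_div_iff₀ (by positivity)]
        gcongr
      have e2 : c' * y ^ 2 ≤ c' / δ ^ 2 * y ^ 4 := by
        rw [div_mul_eq_mul_div, le_div_iff₀ (by positivity)]
        calc c' * y ^ 2 * δ ^ 2 ≤ c' * y ^ 2 * y ^ 2 := by gcongr
          _ = c' * y ^ 4 := by ring
      have e3 : C * y ^ 4 = 4 * D / δ ^ 4 * y ^ 4 + c' / δ ^ 2 * y ^ 4 := by rw [hC]; ring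
      linarith
  -- At the fixed point `x₀` the means are at least -(c+c')/2 - Eτ² and at most -c' + 12Cτ². Here
  -- `E` depends on `x₀` but not on τ, so τ → 0 contradicts c < c'.
  obtain ⟨E, hE⟩ := resolventMean_ge_of_partial_sums hg hg' (by linarith : 0 ≤ (c + c') / 2)
    (h x₀ ((c + c') / 2) (by linarith))
  have hfin : ∀ τ : ℝ, 0 < τ → (c' - c) / 2 ≤ (12 * C + E) * τ ^ 2 := fun τ hτ => by
    have := hE τ hτ
    have := resolventMean_le_of_second_difference hg hg' hall hτ
    linarith
  have hlim : Tendsto (fun τ : ℝ => (12 * C + E) * τ ^ 2) (𝓝[>] 0) (𝓝 0) := by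
    have : Continuous fun τ : ℝ => (12 * C + E) * τ ^ 2 := by fun_prop
    simpa using (this.tendsto 0).mono_left nhdsWithin_le_nhds
  have := ge_of_tendsto hlim (eventually_nhdsWithin_of_forall fun τ hτ => hfin τ hτ)
  linarith

end Positivity

/-! ### Orthogonality of the trigonometric system. -/

section FourierIntegrals

lemma integral_Icc_cos_int_mul (k : ℤ) :
    ∫ x in Set.Icc (-Real.pi) Real.pi, Real.cos (k * x) = if k = 0 then 2 * Real.pi else 0 := by
  rw [integral_Icc_eq_integral_Ioc, ← intervalIntegral.integral_of_le (by linarith [Real.pi_pos])]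
  split_ifs with hk
  · simp [hk]; ring
  · have hk' : (k : ℝ) ≠ 0 := by exact_mod_cast hk
    rw [intervalIntegral.integral_comp_mul_left (fun x => Real.cos x) hk', integral_cos]
    simp [Real.sin_int_mul_pi]

lemma integral_Icc_sin_int_mul (k : ℤ) :
    ∫ x in Set.Icc (-Real.pi) Real.pi, Real.sin (k * x) = 0 := by
  rw [integral_Icc_eq_integral_Ioc, ← intervalIntegral.integral_of_le (by linarith [Real.pi_pos])]
  rcases eq_or_ne k 0 with hk | hk
  · simp [hk]
  · have hk' : (k : ℝ) ≠ 0 := by exact_mod_cast hk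
    rw [intervalIntegral.integral_comp_mul_left (fun x => Real.sin x) hk', integral_sin]
    simp

lemma Continuous.integrableOn_Icc_pi {f : ℝ → ℝ} (hf : Continuous f) :
    IntegrableOn f (Set.Icc (-Real.pi) Real.pi) := hf.integrableOn_Icc

lemma integral_Icc_cos_mul_cos (m n : ℕ) :
    ∫ x in Set.Icc (-Real.pi) Real.pi, Real.cos (((m : ℝ) + 1) * x) * Real.cos (((n : ℝ) + 1) * x)
      = if m = n then Real.pi else 0 := by
  have h : ∀ x : ℝ, Real.cos (((m : ℝ) + 1) * x) * Real.cos (((n : ℝ) + 1) * x)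
      = (1 / 2) * (Real.cos (((m - n : ℤ) : ℝ) * x) + Real.cos (((m + n + 2 : ℤ) : ℝ) * x)) := by
    intro x
    push_cast
    rw [show ((m : ℝ) - n) * x = (m + 1) * x - (n + 1) * x by ring,
      show ((m : ℝ) + n + 2) * x = (m + 1) * x + (n + 1) * x by ring, Real.cos_add, Real.cos_sub]
    ring
  simp only [h]
  rw [integral_const_mul, integral_add (by apply Continuous.integrableOn_Icc_pi; fun_prop)
    (by apply Continuous.integrableOn_Icc_pi; fun_prop), integral_Icc_cos_int_mul,
    integral_Icc_cos_int_mul, if_neg (by omega : ¬ ((m : ℤ) + n + 2 = 0))]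
  by_cases hmn : m = n
  · simp [hmn]
  · rw [if_neg (by omega), if_neg hmn]; simp

lemma integral_Icc_sin_mul_sin (m n : ℕ) :
    ∫ x in Set.Icc (-Real.pi) Real.pi, Real.sin (((m : ℝ) + 1) * x) * Real.sin (((n : ℝ) + 1) * x)
      = if m = n then Real.pi else 0 := by
  have h : ∀ x : ℝ, Real.sin (((m : ℝ) + 1) * x) * Real.sin (((n : ℝ) + 1) * x)
      = (1 / 2) * (Real.cos (((m - n : ℤ) : ℝ) * x) - Real.cos (((m + n + 2 : ℤ) : ℝ) * x)) := by
    intro x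
    push_cast
    rw [show ((m : ℝ) - n) * x = (m + 1) * x - (n + 1) * x by ring,
      show ((m : ℝ) + n + 2) * x = (m + 1) * x + (n + 1) * x by ring, Real.cos_add, Real.cos_sub]
    ring
  simp only [h]
  rw [integral_const_mul, integral_sub (by apply Continuous.integrableOn_Icc_pi; fun_prop)
    (by apply Continuous.integrableOn_Icc_pi; fun_prop), integral_Icc_cos_int_mul,
    integral_Icc_cos_int_mul, if_neg (by omega : ¬ ((m : ℤ) + n + 2 = 0))]
  by_cases hmn : m = n
  · simp [hmn]
  · rw [if_neg (by omega), if_neg hmn]; simp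

lemma integral_Icc_sin_mul_cos (m n : ℕ) :
    ∫ x in Set.Icc (-Real.pi) Real.pi, Real.sin (((m : ℝ) + 1) * x) * Real.cos (((n : ℝ) + 1) * x)
      = 0 := by
  have h : ∀ x : ℝ, Real.sin (((m : ℝ) + 1) * x) * Real.cos (((n : ℝ) + 1) * x)
      = (1 / 2) * (Real.sin (((m - n : ℤ) : ℝ) * x) + Real.sin (((m + n + 2 : ℤ) : ℝ) * x)) := by
    intro x
    push_cast
    rw [show ((m : ℝ) - n) * x = (m + 1) * x - (n + 1) * x by ring,
      show ((m : ℝ) + n + 2) * x = (m + 1) * x + (n + 1) * x by ring, Real.sin_add, Real.sin_sub]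
    ring
  simp only [h]
  rw [integral_const_mul, integral_add (by apply Continuous.integrableOn_Icc_pi; fun_prop)
    (by apply Continuous.integrableOn_Icc_pi; fun_prop), integral_Icc_sin_int_mul,
    integral_Icc_sin_int_mul]
  simp

end FourierIntegrals

/-! ### Continuity, approximation and Fourier coefficients of the potential. -/

section Potential

variable {h : ℝ} {g g' : ℕ → ℝ}

lemma potential_eq_trigTerm (h : ℝ) (g g' : ℕ → ℝ) (φ : ℝ) :
    potential h g g' φ = h + 2 * ∑' n : ℕ, trigTerm g g' (n + 1) φ / ((n : ℝ) + 1) := by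
  unfold potential trigTerm
  congr 3; funext n
  push_cast
  ring

lemma abs_trigTerm_div_le (g g' : ℕ → ℝ) (n : ℕ) (x : ℝ) :
    |trigTerm g g' (n + 1) x / ((n : ℝ) + 1)|
      ≤ (|g (n + 1)| + |g' (n + 1)|) / ((n : ℝ) + 1) := by
  rw [abs_div, abs_of_pos (by positivity : (0 : ℝ) < (n : ℝ) + 1)]
  gcongr
  exact abs_trigTerm_le _ _ _ _

/-- The Fourier coefficients of the potential are absolutely summable. -/
def SummableCoeff (g g' : ℕ → ℝ) : Prop :=
  Summable fun n : ℕ => (|g (n + 1)| + |g' (n + 1)|) / ((n : ℝ) + 1)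

lemma SummableCoeff.continuous_potential (hs : SummableCoeff g g') (h : ℝ) :
    Continuous (potential h g g') := by
  have : potential h g g' = _ := funext fun φ => potential_eq_trigTerm h g g' φ
  rw [this]
  exact continuous_const.add (continuous_const.mul
    (continuous_tsum (fun n => by fun_prop) hs fun n x => abs_trigTerm_div_le g g' n x))

/-- Uniform approximation of the potential by trigonometric polynomials. -/
lemma SummableCoeff.exists_abs_potential_sub_le (hs : SummableCoeff g g') (h : ℝ) {η : ℝ}
    (hη : 0 < η) : ∃ K : ℕ, ∀ φ, |potential h g g' φ
      - (h + 2 * ∑ n ∈ Finset.range K, trigTerm g g' (n + 1) φ / ((n : ℝ) + 1))| ≤ η := by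
  have h1 := tendstoUniformly_tsum_nat
    (f := fun (n : ℕ) x => trigTerm g g' (n + 1) x / ((n : ℝ) + 1)) hs fun n x => abs_trigTerm_div_le g g' n x
  have h2 := (Metric.tendstoUniformly_iff.1 h1 (η / 2) (by positivity)).exists
  obtain ⟨K, hK⟩ := h2
  refine ⟨K, fun φ => ?_⟩
  have := (hK φ).le
  rw [Real.dist_eq] at this
  rw [potential_eq_trigTerm, add_sub_add_left_eq_sub, ← mul_sub, abs_mul, abs_two]
  linarith

/-- Integration of the Fourier series of the potential against a continuous function. -/
lemma SummableCoeff.hasSum_integral_potential_mul (hs : SummableCoeff g g') (h : ℝ) {w : ℝ → ℝ}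
    (hw : Continuous w) :
    HasSum (fun n : ℕ => 2 *
      ((g (n + 1) * (∫ x in Set.Icc (-Real.pi) Real.pi, Real.cos (((n : ℝ) + 1) * x) * w x)
      + g' (n + 1) * ∫ x in Set.Icc (-Real.pi) Real.pi, Real.sin (((n : ℝ) + 1) * x) * w x)
        / ((n : ℝ) + 1)))
      ((∫ x in Set.Icc (-Real.pi) Real.pi, potential h g g' x * w x)
        - h * ∫ x in Set.Icc (-Real.pi) Real.pi, w x) := by
  have hwi := hw.abs.integrableOn_Icc_pi
  have hF : ∀ n : ℕ, IntegrableOn (fun x => trigTerm g g' (n + 1) x / ((n : ℝ) + 1) * w x)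
      (Set.Icc (-Real.pi) Real.pi) :=
    fun n => Continuous.integrableOn_Icc_pi (by fun_prop)
  have hS : Summable fun n : ℕ => ∫ x in Set.Icc (-Real.pi) Real.pi,
      ‖trigTerm g g' (n + 1) x / ((n : ℝ) + 1) * w x‖ := by
    refine Summable.of_nonneg_of_le (fun n => integral_nonneg fun s => norm_nonneg _) (fun n => ?_)
      (hs.mul_right (∫ x in Set.Icc (-Real.pi) Real.pi, |w x|))
    rw [← integral_const_mul]
    refine integral_mono_of_nonneg (Eventually.of_forall fun s => norm_nonneg _)
      (hwi.const_mul _) (Eventually.of_forall fun x => ?_)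
    simp only [norm_mul, Real.norm_eq_abs]
    gcongr
    exact abs_trigTerm_div_le g g' n x
  have h1 := (hasSum_integral_of_summable_integral_norm hF hS).mul_left 2
  have e1 : 2 * ∫ x in Set.Icc (-Real.pi) Real.pi,
      ∑' n : ℕ, trigTerm g g' (n + 1) x / ((n : ℝ) + 1) * w x
      = (∫ x in Set.Icc (-Real.pi) Real.pi, potential h g g' x * w x)
        - h * ∫ x in Set.Icc (-Real.pi) Real.pi, w x := by
    rw [← integral_const_mul, ← integral_const_mul, ← integral_sub]
    · congr 1; funext x
      rw [tsum_mul_right, potential_eq_trigTerm]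
      ring
    · exact ((hs.continuous_potential h).mul hw).integrableOn_Icc_pi
    · exact (continuous_const.mul hw).integrableOn_Icc_pi
  rw [e1] at h1
  refine h1.congr_fun fun n => ?_
  have : ∀ x : ℝ, trigTerm g g' (n + 1) x / ((n : ℝ) + 1) * w x
      = g (n + 1) / ((n : ℝ) + 1) * (Real.cos (((n : ℝ) + 1) * x) * w x)
        + g' (n + 1) / ((n : ℝ) + 1) * (Real.sin (((n : ℝ) + 1) * x) * w x) := by
    intro x; unfold trigTerm; push_cast; ring
  simp only [this]
  rw [integral_add (by apply Continuous.integrableOn_Icc_pi; fun_prop)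
    (by apply Continuous.integrableOn_Icc_pi; fun_prop), integral_const_mul, integral_const_mul]
  ring

lemma SummableCoeff.integral_potential (hs : SummableCoeff g g') (h : ℝ) :
    ∫ x in Set.Icc (-Real.pi) Real.pi, potential h g g' x = 2 * Real.pi * h := by
  have h1 := hs.hasSum_integral_potential_mul h (continuous_const (y := (1 : ℝ)))
  have hc : ∀ n : ℕ, ∫ x in Set.Icc (-Real.pi) Real.pi, Real.cos (((n : ℝ) + 1) * x) = 0 := by
    intro n
    have := integral_Icc_cos_int_mul (n + 1)
    rw [if_neg (by omega)] at this
    exact_mod_cast this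
  have hsn : ∀ n : ℕ, ∫ x in Set.Icc (-Real.pi) Real.pi, Real.sin (((n : ℝ) + 1) * x) = 0 := by
    intro n
    exact_mod_cast integral_Icc_sin_int_mul (n + 1)
  simp only [mul_one, hc, hsn, mul_zero, add_zero, zero_div] at h1
  have h2 := h1.unique hasSum_zero
  have h3 : ∫ x in Set.Icc (-Real.pi) Real.pi, (1 : ℝ) = 2 * Real.pi := by
    simp [Real.pi_pos.le]; ring
  rw [h3] at h2
  linarith

lemma SummableCoeff.integral_potential_mul_cos (hs : SummableCoeff g g') (h : ℝ) (k : ℕ) :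
    ∫ x in Set.Icc (-Real.pi) Real.pi, potential h g g' x * Real.cos (((k : ℝ) + 1) * x)
      = 2 * Real.pi * (g (k + 1) / ((k : ℝ) + 1)) := by
  have h1 := hs.hasSum_integral_potential_mul h
    (w := fun x => Real.cos (((k : ℝ) + 1) * x)) (by fun_prop)
  have hc : ∫ x in Set.Icc (-Real.pi) Real.pi, Real.cos (((k : ℝ) + 1) * x) = 0 := by
    have := integral_Icc_cos_int_mul (k + 1)
    rw [if_neg (by omega)] at this
    exact_mod_cast this
  simp only [integral_Icc_cos_mul_cos, integral_Icc_sin_mul_cos, hc, mul_zero, add_zero,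
    sub_zero] at h1
  rw [h1.unique (hasSum_single k fun n hn => by simp [hn])]
  simp
  ring

lemma SummableCoeff.integral_potential_mul_sin (hs : SummableCoeff g g') (h : ℝ) (k : ℕ) :
    ∫ x in Set.Icc (-Real.pi) Real.pi, potential h g g' x * Real.sin (((k : ℝ) + 1) * x)
      = 2 * Real.pi * (g' (k + 1) / ((k : ℝ) + 1)) := by
  have h1 := hs.hasSum_integral_potential_mul h
    (w := fun x => Real.sin (((k : ℝ) + 1) * x)) (by fun_prop)
  have hc : ∫ x in Set.Icc (-Real.pi) Real.pi, Real.sin (((k : ℝ) + 1) * x) = 0 := by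
    exact_mod_cast integral_Icc_sin_int_mul (k + 1)
  have hcs : ∀ n : ℕ, ∫ x in Set.Icc (-Real.pi) Real.pi,
      Real.cos (((n : ℝ) + 1) * x) * Real.sin (((k : ℝ) + 1) * x) = 0 := by
    intro n
    simpa only [mul_comm] using integral_Icc_sin_mul_cos k n
  simp only [integral_Icc_sin_mul_sin, hcs, hc, mul_zero, zero_add, sub_zero] at h1
  rw [h1.unique (hasSum_single k fun n hn => by simp [hn])]
  simp
  ring

end Potential

/-! ### The Szegő exponent. -/

section Szego

variable {g g' : ℕ → ℝ}

lemma logSymbolCoeff_eq {V : ℝ → ℝ} (hV : Continuous V) (β : ℝ) (k : ℤ) :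
    logSymbolCoeff V β k = (1 / (2 * Real.pi) : ℂ) * (β : ℂ) *
      (((∫ x in Set.Icc (-Real.pi) Real.pi, V x * Real.cos (k * x) : ℝ) : ℂ)
      - Complex.I * ((∫ x in Set.Icc (-Real.pi) Real.pi, V x * Real.sin (k * x) : ℝ) : ℂ)) := by
  unfold logSymbolCoeff
  have hpi : -Real.pi ≤ Real.pi := by linarith [Real.pi_pos]
  rw [integral_Icc_eq_integral_Ioc, integral_Icc_eq_integral_Ioc,
    ← intervalIntegral.integral_of_le hpi, ← intervalIntegral.integral_of_le hpi, mul_assoc]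
  congr 1
  rw [← intervalIntegral.integral_ofReal, ← intervalIntegral.integral_ofReal,
    ← intervalIntegral.integral_const_mul, ← intervalIntegral.integral_sub,
    ← intervalIntegral.integral_const_mul]
  · congr 1; funext x
    rw [show -(Complex.I * (k : ℂ) * (x : ℂ)) = (-((k : ℂ) * x)) * Complex.I by ring,
      Complex.exp_mul_I]
    push_cast
    rw [Complex.cos_neg, Complex.sin_neg]
    ring
  · exact Continuous.intervalIntegrable (by fun_prop) _ _
  · exact Continuous.intervalIntegrable (by fun_prop) _ _

theorem SummableCoeff.szegoExponent_eq (hs : SummableCoeff g g') (h γ : ℝ) {N : ℕ} (hN : 1 ≤ N) :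
    szegoExponent N (potential h g g') (γ * N) / (N : ℂ) ^ 2 =
      ((γ * h + γ ^ 2 *
        ∑' n : ℕ, (g (n + 1) ^ 2 + g' (n + 1) ^ 2) / ((n : ℝ) + 1) : ℝ) : ℂ) := by
  have hV := hs.continuous_potential h
  have hpi : (Real.pi : ℂ) ≠ 0 := by exact_mod_cast Real.pi_ne_zero
  have hN0 : (N : ℂ) ≠ 0 := by exact_mod_cast (by omega : N ≠ 0)
  have h0 : logSymbolCoeff (potential h g g') (γ * N) 0 = γ * N * h := by
    rw [logSymbolCoeff_eq hV]
    simp only [Int.cast_zero, zero_mul, Real.cos_zero, Real.sin_zero, mul_one, mul_zero,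
      hs.integral_potential, integral_zero]
    push_cast
    simp only [mul_zero, sub_zero]
    field_simp
  -- For n ≥ 1, c_n = β(g_n - i g'_n)/n and c_{-n} is its conjugate, so n c_n c_{-n} = β²(g_n² +
  -- g'_n²)/n.
  have hk : ∀ k : ℕ, ((k : ℂ) + 1) * logSymbolCoeff (potential h g g') (γ * N) ((k : ℤ) + 1) *
      logSymbolCoeff (potential h g g') (γ * N) (-((k : ℤ) + 1))
      = (((γ * N) ^ 2 * ((g (k + 1) ^ 2 + g' (k + 1) ^ 2) / ((k : ℝ) + 1)) : ℝ) : ℂ) := by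
    intro k
    have hk0 : (k : ℂ) + 1 ≠ 0 := by exact_mod_cast (by omega : k + 1 ≠ 0)
    rw [logSymbolCoeff_eq hV, logSymbolCoeff_eq hV]
    push_cast
    simp only [neg_mul, Real.cos_neg, Real.sin_neg, mul_neg, integral_neg,
      hs.integral_potential_mul_cos, hs.integral_potential_mul_sin]
    push_cast
    field_simp
    linear_combination (-(γ : ℂ) ^ 2 * (g' (k + 1) : ℂ) ^ 2) * Complex.I_sq
  unfold szegoExponent
  simp only [hk, h0]
  rw [← Complex.ofReal_tsum, tsum_mul_left]
  push_cast
  field_simp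

end Szego

/-! ### The regularized logarithmic kernel. -/

section Kernel

/-- Partial sums of the series `2 ∑ r ^ n cos (n θ) / n` of `-log |1 - r e ^ {i θ}| ^ 2`. -/
noncomputable def logKernel (r : ℝ) (K : ℕ) (θ : ℝ) : ℝ :=
  2 * ∑ n ∈ Finset.range K, r ^ (n + 1) * Real.cos (((n : ℝ) + 1) * θ) / ((n : ℝ) + 1)

lemma norm_exp_sub_mul_exp_sq (r a b : ℝ) :
    ‖Complex.exp (Complex.I * a) - r * Complex.exp (Complex.I * b)‖ ^ 2
      = 1 - 2 * r * Real.cos (a - b) + r ^ 2 := by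
  rw [Complex.sq_norm, Complex.normSq_apply, mul_comm Complex.I (a : ℂ),
    mul_comm Complex.I (b : ℂ)]
  simp only [Complex.sub_re, Complex.sub_im, Complex.re_ofReal_mul, Complex.im_ofReal_mul,
    Complex.exp_ofReal_mul_I_re, Complex.exp_ofReal_mul_I_im, Real.cos_sub]
  linear_combination Real.sin_sq_add_cos_sq a + r ^ 2 * Real.sin_sq_add_cos_sq b

/-- After multiplication by (1+r)² the difference of the two sides is 2(1-r)²(1 + cos(a-b)). The
constant tends to 1 as r → 1, so regularizing costs arbitrarily little per pair. -/
lemma norm_exp_sub_exp_sq_le {r : ℝ} (hr : 0 < r) (a b : ℝ) :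
    ‖Complex.exp (Complex.I * a) - Complex.exp (Complex.I * b)‖ ^ 2
      ≤ 4 / (1 + r) ^ 2 * ‖Complex.exp (Complex.I * a) - r * Complex.exp (Complex.I * b)‖ ^ 2 := by
  have h1 := norm_exp_sub_mul_exp_sq 1 a b
  rw [Complex.ofReal_one, one_mul] at h1
  rw [h1, norm_exp_sub_mul_exp_sq, div_mul_eq_mul_div, le_div_iff₀ (by positivity)]
  nlinarith [mul_nonneg (sq_nonneg (1 - r)) (by linarith [Real.neg_one_le_cos (a - b)] :
    0 ≤ 1 + Real.cos (a - b))]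

lemma norm_exp_sub_mul_exp_sq_pos {r : ℝ} (hr0 : 0 < r) (hr : r < 1) (a b : ℝ) :
    0 < ‖Complex.exp (Complex.I * a) - r * Complex.exp (Complex.I * b)‖ ^ 2 := by
  rw [norm_exp_sub_mul_exp_sq]
  nlinarith [Real.cos_le_one (a - b), sq_pos_of_pos (sub_pos.2 hr)]

/-- Real part of the Taylor series of -log(1 - z) at z = r e^{i(b-a)}. -/
lemma hasSum_log_norm_exp_sub {r : ℝ} (hr0 : 0 < r) (hr : r < 1) (a b : ℝ) :
    HasSum (fun n : ℕ => r ^ (n + 1) * Real.cos (((n : ℝ) + 1) * (a - b)) / ((n : ℝ) + 1))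
      (-(Real.log (‖Complex.exp (Complex.I * a) - r * Complex.exp (Complex.I * b)‖ ^ 2)) / 2) := by
  set z : ℂ := r * Complex.exp (((b - a : ℝ) : ℂ) * Complex.I) with hz
  have hzn : ‖z‖ < 1 := by
    rw [hz, norm_mul, Complex.norm_exp_ofReal_mul_I, mul_one, Complex.norm_real,
      Real.norm_of_nonneg hr0.le]
    exact hr
  have h1 := (hasSum_nat_add_iff' 1).2 (Complex.hasSum_taylorSeries_neg_log hzn)
  simp only [Finset.range_one, Finset.sum_singleton, pow_zero, Nat.cast_zero, div_zero,
    sub_zero] at h1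
  have h2 := Complex.hasSum_re h1
  have hnorm : ‖Complex.exp (Complex.I * a) - r * Complex.exp (Complex.I * b)‖ = ‖1 - z‖ := by
    have : Complex.exp (Complex.I * a) - r * Complex.exp (Complex.I * b)
        = Complex.exp (a * Complex.I) * (1 - z) := by
      rw [hz, mul_sub, mul_one, mul_left_comm, ← Complex.exp_add]
      push_cast
      ring_nf
    rw [this, norm_mul, Complex.norm_exp_ofReal_mul_I, one_mul]
  rw [Complex.neg_re, Complex.log_re] at h2
  rw [hnorm, Real.log_pow]
  refine (h2.congr_fun fun n => ?_).trans_eq ?_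
  · have e : z ^ (n + 1) / ((n + 1 : ℕ) : ℂ) = ((r ^ (n + 1) / ((n : ℝ) + 1) : ℝ) : ℂ)
        * Complex.exp (((-(((n : ℝ) + 1) * (a - b)) : ℝ) : ℂ) * Complex.I) := by
      rw [hz, mul_pow, ← Complex.exp_nat_mul]
      push_cast
      ring_nf
    rw [e, Complex.re_ofReal_mul, Complex.exp_ofReal_mul_I_re, Real.cos_neg]
    ring
  · push_cast; ring_nf

lemma exists_abs_log_add_logKernel_le {r η : ℝ} (hr0 : 0 < r) (hr : r < 1) (hη : 0 < η) :
    ∃ K₀ : ℕ, ∀ K, K₀ ≤ K → ∀ a b : ℝ,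
      |Real.log (‖Complex.exp (Complex.I * a) - r * Complex.exp (Complex.I * b)‖ ^ 2)
        + logKernel r K (a - b)| ≤ η := by
  have hs : Summable fun n : ℕ => r ^ (n + 1) :=
    (summable_nat_add_iff 1).2 (summable_geometric_of_lt_one hr0.le hr)
  have h1 := tendstoUniformly_tsum_nat
    (f := fun (n : ℕ) (θ : ℝ) => r ^ (n + 1) * Real.cos (((n : ℝ) + 1) * θ) / ((n : ℝ) + 1)) hs
    fun n θ => by
      rw [norm_div, norm_mul, Real.norm_of_nonneg (by positivity : 0 ≤ r ^ (n + 1)),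
        Real.norm_of_nonneg (by positivity : 0 ≤ (n : ℝ) + 1)]
      rw [div_le_iff₀ (by positivity)]
      have : ‖Real.cos (((n : ℝ) + 1) * θ)‖ ≤ 1 := Real.abs_cos_le_one _
      have h0 : 0 < r ^ (n + 1) := by positivity
      gcongr
      have : (0 : ℝ) ≤ n := by positivity
      linarith
  obtain ⟨K₀, hK₀⟩ := eventually_atTop.1 (Metric.tendstoUniformly_iff.1 h1 (η / 2) (by positivity))
  refine ⟨K₀, fun K hK a b => ?_⟩
  have := (hK₀ K hK (a - b)).le
  rw [(hasSum_log_norm_exp_sub hr0 hr a b).tsum_eq, Real.dist_eq, abs_le] at this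
  unfold logKernel
  rw [abs_le]
  constructor <;> linarith [this.1, this.2]

lemma sum_sum_Ioi_eq {N : ℕ} (F : Fin N → Fin N → ℝ) (hF : ∀ j k, F j k = F k j) :
    2 * ∑ j, ∑ k ∈ Finset.Ioi j, F j k = ∑ j, ∑ k, F j k - ∑ j, F j j := by
  have h1 := Finset.sum_sum_Ioi_add_eq_sum_sum_off_diag F
  have h2 : ∀ j, ∑ k ∈ {j}ᶜ, F k j = ∑ k, F j k - F j j := by
    intro j
    rw [← Finset.sum_compl_add_sum {j} (fun k => F j k)]
    simp [fun k => hF k j]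
  simp only [h2, Finset.sum_sub_distrib] at h1
  rw [← h1, Finset.mul_sum]
  refine Finset.sum_congr rfl fun j _ => ?_
  rw [Finset.mul_sum]
  refine Finset.sum_congr rfl fun k _ => ?_
  rw [hF k j]; ring

lemma sum_sum_cos_sub {N : ℕ} (φ : Fin N → ℝ) (c : ℝ) :
    ∑ j, ∑ k, Real.cos (c * (φ j - φ k))
      = (∑ j, Real.cos (c * φ j)) ^ 2 + (∑ j, Real.sin (c * φ j)) ^ 2 := by
  rw [sq, sq, Finset.sum_mul_sum, Finset.sum_mul_sum, ← Finset.sum_add_distrib]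
  refine Finset.sum_congr rfl fun j _ => ?_
  rw [← Finset.sum_add_distrib]
  refine Finset.sum_congr rfl fun k _ => ?_
  rw [mul_sub, Real.cos_sub]

/-- The pair energy is diagonal in the moments of the configuration, which makes completing the
square possible; -N removes the diagonal j = k. -/
lemma sum_sum_Ioi_logKernel {N : ℕ} (r : ℝ) (K : ℕ) (φ : Fin N → ℝ) :
    ∑ j, ∑ k ∈ Finset.Ioi j, logKernel r K (φ j - φ k)
      = ∑ n ∈ Finset.range K, r ^ (n + 1) / ((n : ℝ) + 1) *
        ((∑ j, Real.cos (((n : ℝ) + 1) * φ j)) ^ 2 + (∑ j, Real.sin (((n : ℝ) + 1) * φ j)) ^ 2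
          - N) := by
  have h1 := sum_sum_Ioi_eq (fun j k => logKernel r K (φ j - φ k)) (fun j k => by
    unfold logKernel
    congr 1
    refine Finset.sum_congr rfl fun n _ => ?_
    rw [← Real.cos_neg]; ring_nf)
  refine mul_left_cancel₀ two_ne_zero (h1.trans ?_)
  unfold logKernel
  simp only [sub_self, mul_zero, Real.cos_zero, mul_one, Finset.sum_const, Finset.card_univ,
    Fintype.card_fin, nsmul_eq_mul, ← Finset.mul_sum]
  rw [← mul_assoc, mul_comm (N : ℝ) 2, mul_assoc, ← mul_sub]
  congr 1
  simp only [fun j => Finset.sum_comm (s := (Finset.univ : Finset (Fin N)))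
    (t := Finset.range K) (f := fun k n => r ^ (n + 1) *
      Real.cos (((n : ℝ) + 1) * (φ j - φ k)) / ((n : ℝ) + 1))]
  rw [Finset.sum_comm, Finset.mul_sum, ← Finset.sum_sub_distrib]
  refine Finset.sum_congr rfl fun n _ => ?_
  rw [← sum_sum_cos_sub]
  simp only [mul_div_right_comm, ← Finset.mul_sum]
  ring

end Kernel

/-! ### The upper bound. -/

section Upper

lemma integrableOn_cube {N : ℕ} {f : (Fin N → ℝ) → ℝ} (hf : Continuous f) :
    IntegrableOn f (Set.Icc (fun _ : Fin N => -Real.pi) (fun _ : Fin N => Real.pi)) :=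
  hf.continuousOn.integrableOn_compact isCompact_Icc

lemma integral_Icc_pi_one (N : ℕ) :
    ∫ _φ in Set.Icc (fun _ : Fin N => -Real.pi) (fun _ : Fin N => Real.pi), (1 : ℝ)
      = (2 * Real.pi) ^ N := by
  simp only [integral_const, smul_eq_mul, mul_one, MeasurableSet.univ, measureReal_restrict_apply,
    Set.univ_inter]
  rw [measureReal_def, Real.volume_Icc_pi_toReal]
  · simp; ring
  · intro i; simp only; linarith [Real.pi_pos]

/-- The integrand of the partition function. -/
noncomputable def gibbsWeight (N : ℕ) (V : ℝ → ℝ) (β : ℝ) (r : ℝ) (φ : Fin N → ℝ) : ℝ :=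
  (∏ j : Fin N, ∏ k ∈ Finset.Ioi j,
      ‖Complex.exp (Complex.I * (φ j : ℂ)) - r * Complex.exp (Complex.I * (φ k : ℂ))‖ ^ 2)
    * Real.exp (β * ∑ j : Fin N, V (φ j))

lemma continuous_gibbsWeight (N : ℕ) {V : ℝ → ℝ} (hV : Continuous V) (β : ℝ) :
    Continuous (Function.uncurry (gibbsWeight N V β)) := by
  unfold gibbsWeight Function.uncurry
  fun_prop

lemma partitionFunction_eq (N : ℕ) (V : ℝ → ℝ) (β : ℝ) :
    partitionFunction N V β = (1 / (N.factorial : ℝ)) *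
      ((∫ φ in Set.Icc (fun _ : Fin N => -Real.pi) (fun _ : Fin N => Real.pi),
        gibbsWeight N V β 1 φ) * (1 / (2 * Real.pi)) ^ N) := by
  unfold partitionFunction gibbsWeight
  rw [integral_mul_const]
  simp

lemma partitionFunction_le_of_gibbsWeight_le {N : ℕ} {V : ℝ → ℝ} (hV : Continuous V) {β M : ℝ}
    (hM : ∀ φ, gibbsWeight N V β 1 φ ≤ M) : partitionFunction N V β ≤ M := by
  have hc : Continuous (gibbsWeight N V β 1) :=
    (continuous_gibbsWeight N hV β).uncurry_left 1
  have hpos : ∀ φ, 0 ≤ gibbsWeight N V β 1 φ := fun φ => by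
    unfold gibbsWeight; positivity
  have hM0 : 0 ≤ M := (hpos 0).trans (hM 0)
  have h1 : ∫ φ in Set.Icc (fun _ : Fin N => -Real.pi) (fun _ : Fin N => Real.pi),
        gibbsWeight N V β 1 φ ≤ M * (2 * Real.pi) ^ N := by
    have hi : IntegrableOn (fun _ : Fin N → ℝ => (1 : ℝ))
      (Set.Icc (fun _ : Fin N => -Real.pi) (fun _ : Fin N => Real.pi)) :=
      integrableOn_cube continuous_const
    have hle := setIntegral_mono (integrableOn_cube hc) (hi.const_mul M)
      fun φ => (hM φ).trans_eq (mul_one M).symm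
    have e : ∫ φ in Set.Icc (fun _ : Fin N => -Real.pi) (fun _ : Fin N => Real.pi), M * (1 : ℝ)
        = M * (2 * Real.pi) ^ N := by
      rw [integral_const_mul M, integral_Icc_pi_one N]
    exact hle.trans_eq e
  have hpi : 0 < 2 * Real.pi := by positivity
  have h2 : (∫ φ in Set.Icc (fun _ : Fin N => -Real.pi) (fun _ : Fin N => Real.pi),
        gibbsWeight N V β 1 φ) * (1 / (2 * Real.pi)) ^ N ≤ M := by
    rw [div_pow, one_pow, mul_one_div, div_le_iff₀ (by positivity)]
    exact h1
  rw [partitionFunction_eq]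
  have hf : 1 / (N.factorial : ℝ) ≤ 1 := by
    rw [div_le_one (by positivity)]
    exact_mod_cast N.factorial_pos
  calc _ ≤ 1 / (N.factorial : ℝ) * M := by gcongr
    _ ≤ 1 * M := by gcongr
    _ = M := one_mul M

variable {g g' : ℕ → ℝ} {h γ : ℝ}

/-- Completing the square in the energy. -/
lemma gibbsWeight_le {r η : ℝ} (hr0 : 0 < r) (hr : r < 1) (hη : 0 < η) (hγ : 0 ≤ γ) {K₁ K : ℕ}
    (hK : K₁ ≤ K)
    (hK₁ : ∀ φ, |potential h g g' φ
      - (h + 2 * ∑ n ∈ Finset.range K₁, trigTerm g g' (n + 1) φ / ((n : ℝ) + 1))| ≤ η)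
    (hKr : ∀ a b : ℝ,
      |Real.log (‖Complex.exp (Complex.I * a) - r * Complex.exp (Complex.I * b)‖ ^ 2)
        + logKernel r K (a - b)| ≤ η) (N : ℕ) (φ : Fin N → ℝ) :
    gibbsWeight N (potential h g g') (γ * N) 1 φ ≤ Real.exp
      ((N : ℝ) ^ 2 * (Real.log (4 / (1 + r) ^ 2) + η + γ * (h + η) + γ ^ 2 *
        ∑ n ∈ Finset.range K₁, (g (n + 1) ^ 2 + g' (n + 1) ^ 2) / ((n : ℝ) + 1) / r ^ (n + 1))
        + N * ∑ n ∈ Finset.range K, r ^ (n + 1) / ((n : ℝ) + 1)) := by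
  set c : ℝ := Real.log (4 / (1 + r) ^ 2) + η with hc
  set P : ℕ → ℝ := fun n => ∑ j, Real.cos (((n : ℝ) + 1) * φ j) with hP
  set Q : ℕ → ℝ := fun n => ∑ j, Real.sin (((n : ℝ) + 1) * φ j) with hQ
  have hq1 : 1 ≤ 4 / (1 + r) ^ 2 := by
    rw [le_div_iff₀ (by positivity)]; nlinarith
  have hc0 : 0 ≤ c := add_nonneg (Real.log_nonneg hq1) hη.le
  have hpair : ∀ a b : ℝ, ‖Complex.exp (Complex.I * a) - Complex.exp (Complex.I * b)‖ ^ 2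
      ≤ Real.exp (c - logKernel r K (a - b)) := by
    intro a b
    refine (norm_exp_sub_exp_sq_le hr0 a b).trans ?_
    have hp := norm_exp_sub_mul_exp_sq_pos hr0 hr a b
    rw [← Real.log_le_iff_le_exp (by positivity), Real.log_mul (by positivity) hp.ne']
    linarith [(abs_le.1 (hKr a b)).2]
  have hprod : (∏ j : Fin N, ∏ k ∈ Finset.Ioi j,
      ‖Complex.exp (Complex.I * (φ j : ℂ)) - ((1 : ℝ) : ℂ) * Complex.exp (Complex.I * (φ k : ℂ))‖
        ^ 2)
      ≤ Real.exp (∑ j, ∑ k ∈ Finset.Ioi j, (c - logKernel r K (φ j - φ k))) := by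
    rw [Real.exp_sum]
    refine Finset.prod_le_prod (fun _ _ => by positivity) fun j _ => ?_
    rw [Real.exp_sum]
    refine Finset.prod_le_prod (fun _ _ => by positivity) fun k _ => ?_
    rw [Complex.ofReal_one, one_mul]
    exact hpair _ _
  have hcard : ∑ j : Fin N, ∑ k ∈ Finset.Ioi j, c ≤ (N : ℝ) ^ 2 * c := by
    have : ∀ j : Fin N, ∑ k ∈ Finset.Ioi j, c ≤ N * c := by
      intro j
      rw [Finset.sum_const, nsmul_eq_mul]
      gcongr
      exact (Finset.card_le_univ _).trans (by simp)
    refine (Finset.sum_le_sum fun j _ => this j).trans ?_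
    simp; nlinarith
  have hV : ∑ j, potential h g g' (φ j) ≤ N * (h + η) + 2 * ∑ n ∈ Finset.range K₁,
      (g (n + 1) * P n + g' (n + 1) * Q n) / ((n : ℝ) + 1) := by
    have h1 : ∀ j, potential h g g' (φ j) ≤ (h + η)
        + 2 * ∑ n ∈ Finset.range K₁, trigTerm g g' (n + 1) (φ j) / ((n : ℝ) + 1) := fun j => by
      linarith [(abs_le.1 (hK₁ (φ j))).2]
    refine (Finset.sum_le_sum fun j _ => h1 j).trans (le_of_eq ?_)
    rw [Finset.sum_add_distrib, ← Finset.mul_sum, Finset.sum_comm]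
    congr 1
    · simp [mul_add]
    · congr 1
      refine Finset.sum_congr rfl fun n _ => ?_
      rw [← Finset.sum_div]
      simp only [trigTerm, hP, hQ, Finset.sum_add_distrib, Finset.mul_sum]
      push_cast
      rfl
  -- The square is completed mode by mode; dividing by r^{n+1} is the price of the regularization.
  have hsq : ∀ n : ℕ, 2 * (γ * N) * ((g (n + 1) * P n + g' (n + 1) * Q n) / ((n : ℝ) + 1))
      - r ^ (n + 1) / ((n : ℝ) + 1) * (P n ^ 2 + Q n ^ 2)
      ≤ γ ^ 2 * (N : ℝ) ^ 2 *
        ((g (n + 1) ^ 2 + g' (n + 1) ^ 2) / ((n : ℝ) + 1) / r ^ (n + 1)) := by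
    intro n
    have hR : 0 < r ^ (n + 1) := by positivity
    have e : γ ^ 2 * (N : ℝ) ^ 2 * ((g (n + 1) ^ 2 + g' (n + 1) ^ 2) / ((n : ℝ) + 1) / r ^ (n + 1))
        - (2 * (γ * N) * ((g (n + 1) * P n + g' (n + 1) * Q n) / ((n : ℝ) + 1))
          - r ^ (n + 1) / ((n : ℝ) + 1) * (P n ^ 2 + Q n ^ 2))
        = ((γ * N * g (n + 1) - r ^ (n + 1) * P n) ^ 2
          + (γ * N * g' (n + 1) - r ^ (n + 1) * Q n) ^ 2) / (((n : ℝ) + 1) * r ^ (n + 1)) := by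
      field_simp
      ring
    have : 0 ≤ ((γ * N * g (n + 1) - r ^ (n + 1) * P n) ^ 2
          + (γ * N * g' (n + 1) - r ^ (n + 1) * Q n) ^ 2) / (((n : ℝ) + 1) * r ^ (n + 1)) := by
      positivity
    linarith
  -- Kernel modes beyond those of the truncated potential lower the exponent and can be discarded.
  have hdrop : ∑ n ∈ Finset.range K₁, r ^ (n + 1) / ((n : ℝ) + 1) * (P n ^ 2 + Q n ^ 2)
      ≤ ∑ n ∈ Finset.range K, r ^ (n + 1) / ((n : ℝ) + 1) * (P n ^ 2 + Q n ^ 2) :=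
    Finset.sum_le_sum_of_subset_of_nonneg (Finset.range_mono hK) fun n _ _ => by positivity
  have hker := sum_sum_Ioi_logKernel r K φ
  simp only [mul_sub, Finset.sum_sub_distrib, ← Finset.sum_mul] at hker
  have hsum := Finset.sum_le_sum (s := Finset.range K₁) fun n _ => hsq n
  rw [Finset.sum_sub_distrib, ← Finset.mul_sum, ← Finset.mul_sum] at hsum
  have hVm := mul_le_mul_of_nonneg_left hV (by positivity : 0 ≤ γ * (N : ℝ))
  unfold gibbsWeight
  refine (mul_le_mul_of_nonneg_right hprod (Real.exp_pos _).le).trans ?_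
  rw [← Real.exp_add]
  refine Real.exp_le_exp.2 ?_
  simp only [Finset.sum_sub_distrib]
  rw [hker]
  linarith

/-- The upper bound for the partition function, valid for every coupling. -/
theorem SummableCoeff.partitionFunction_le (hs : SummableCoeff g g')
    (hsq : Summable fun n : ℕ => (g (n + 1) ^ 2 + g' (n + 1) ^ 2) / ((n : ℝ) + 1)) (h : ℝ)
    (hγ : 0 ≤ γ) {δ : ℝ} (hδ : 0 < δ) :
    ∃ B : ℝ, ∀ N : ℕ, partitionFunction N (potential h g g') (γ * N) ≤ Real.exp
      ((N : ℝ) ^ 2 * (γ * h + γ ^ 2 *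
        (∑' n : ℕ, (g (n + 1) ^ 2 + g' (n + 1) ^ 2) / ((n : ℝ) + 1)) + δ) + N * B) := by
  set η : ℝ := δ / (2 * (1 + γ)) with hη
  have hη0 : 0 < η := by positivity
  obtain ⟨K₁, hK₁⟩ := hs.exists_abs_potential_sub_le h hη0
  -- With `K₁` fixed first, the sum is finite and r → 1 removes both costs of the regularization.
  have hlim : Tendsto (fun r : ℝ => Real.log (4 / (1 + r) ^ 2) + γ ^ 2 *
      ∑ n ∈ Finset.range K₁, (g (n + 1) ^ 2 + g' (n + 1) ^ 2) / ((n : ℝ) + 1) / r ^ (n + 1))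
      (𝓝[<] 1) (𝓝 (Real.log (4 / (1 + 1) ^ 2) + γ ^ 2 *
      ∑ n ∈ Finset.range K₁, (g (n + 1) ^ 2 + g' (n + 1) ^ 2) / ((n : ℝ) + 1) / 1 ^ (n + 1))) := by
    refine Tendsto.mono_left ?_ nhdsWithin_le_nhds
    refine ContinuousAt.tendsto (f := fun r : ℝ => Real.log (4 / (1 + r) ^ 2) + γ ^ 2 *
      ∑ n ∈ Finset.range K₁, (g (n + 1) ^ 2 + g' (n + 1) ^ 2) / ((n : ℝ) + 1) / r ^ (n + 1)) ?_
    refine ContinuousAt.add ?_ (continuousAt_const.mul ?_)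
    · exact ContinuousAt.log (by fun_prop (disch := norm_num)) (by norm_num)
    · exact tendsto_finsetSum _ fun n _ => by
        have : ContinuousAt (fun r : ℝ => (g (n + 1) ^ 2 + g' (n + 1) ^ 2) / ((n : ℝ) + 1)
          / r ^ (n + 1)) 1 := by fun_prop (disch := norm_num)
        exact this
  have hS : ∑ n ∈ Finset.range K₁, (g (n + 1) ^ 2 + g' (n + 1) ^ 2) / ((n : ℝ) + 1)
      ≤ ∑' n : ℕ, (g (n + 1) ^ 2 + g' (n + 1) ^ 2) / ((n : ℝ) + 1) :=
    hsq.sum_le_tsum _ fun n _ => by positivity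
  have hlt : Real.log (4 / (1 + 1) ^ 2) + γ ^ 2 *
      ∑ n ∈ Finset.range K₁, (g (n + 1) ^ 2 + g' (n + 1) ^ 2) / ((n : ℝ) + 1) / 1 ^ (n + 1)
      < γ ^ 2 * (∑' n : ℕ, (g (n + 1) ^ 2 + g' (n + 1) ^ 2) / ((n : ℝ) + 1)) + δ / 2 := by
    have := mul_le_mul_of_nonneg_left hS (sq_nonneg γ)
    norm_num
    linarith
  have hev : ∀ᶠ r : ℝ in 𝓝[<] 1, 0 < r :=
    nhdsWithin_le_nhds (lt_mem_nhds one_pos)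
  obtain ⟨r, ⟨hr1, hr0⟩, hr⟩ := (((hlim.eventually (gt_mem_nhds hlt)).and hev).and
    self_mem_nhdsWithin).exists
  have hr' : r < 1 := hr
  obtain ⟨K₀, hK₀⟩ := exists_abs_log_add_logKernel_le hr0 hr' hη0
  refine ⟨∑ n ∈ Finset.range (max K₀ K₁), r ^ (n + 1) / ((n : ℝ) + 1), fun N => ?_⟩
  refine (partitionFunction_le_of_gibbsWeight_le (hs.continuous_potential h)
    (gibbsWeight_le hr0 hr' hη0 hγ (le_max_right K₀ K₁) hK₁ (hK₀ _ (le_max_left _ _)) N)).trans ?_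
  refine Real.exp_le_exp.2 (add_le_add_left (mul_le_mul_of_nonneg_left ?_ (by positivity)) _)
  have : η + γ * η = δ / 2 := by rw [hη]; field_simp
  linarith

end Upper

/-! ### Expectations under a product density. -/

section CubeMean

/-- The integral over the cube `[-π, π] ^ N` against the product density `∏ w (φ j)`. -/
noncomputable def cubeMean {N : ℕ} (w : ℝ → ℝ) (F : (Fin N → ℝ) → ℝ) : ℝ :=
  ∫ φ in Set.Icc (fun _ : Fin N => -Real.pi) (fun _ : Fin N => Real.pi), (∏ i, w (φ i)) * F φ

lemma integral_cube_prod {N : ℕ} (f : Fin N → ℝ → ℝ) :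
    ∫ φ in Set.Icc (fun _ : Fin N => -Real.pi) (fun _ : Fin N => Real.pi), ∏ i, f i (φ i)
      = ∏ i, ∫ x in Set.Icc (-Real.pi) Real.pi, f i x := by
  rw [← Set.pi_univ_Icc, volume_pi, Measure.restrict_pi_pi]
  exact integral_fintype_prod_eq_prod f

variable {N : ℕ} {w : ℝ → ℝ}

lemma integrableOn_cubeMean (hw : Continuous w) {F : (Fin N → ℝ) → ℝ} (hF : Continuous F) :
    IntegrableOn (fun φ => (∏ i, w (φ i)) * F φ)
      (Set.Icc (fun _ : Fin N => -Real.pi) (fun _ : Fin N => Real.pi)) :=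
  integrableOn_cube (by fun_prop)

lemma cubeMean_add (hw : Continuous w) {F G : (Fin N → ℝ) → ℝ} (hF : Continuous F)
    (hG : Continuous G) : cubeMean w (fun φ => F φ + G φ) = cubeMean w F + cubeMean w G := by
  unfold cubeMean
  rw [← integral_add (integrableOn_cubeMean hw hF) (integrableOn_cubeMean hw hG)]
  simp only [mul_add]

lemma cubeMean_const_mul (c : ℝ) (F : (Fin N → ℝ) → ℝ) :
    cubeMean w (fun φ => c * F φ) = c * cubeMean w F := by
  unfold cubeMean
  rw [← integral_const_mul]
  simp only [mul_left_comm]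

lemma cubeMean_sum (hw : Continuous w) {ι : Type*} (s : Finset ι) {F : ι → (Fin N → ℝ) → ℝ}
    (hF : ∀ i, Continuous (F i)) :
    cubeMean w (fun φ => ∑ i ∈ s, F i φ) = ∑ i ∈ s, cubeMean w (F i) := by
  unfold cubeMean
  rw [← integral_finsetSum _ fun i _ => integrableOn_cubeMean hw (hF i)]
  simp only [Finset.mul_sum]

lemma cubeMean_one (hw1 : ∫ x in Set.Icc (-Real.pi) Real.pi, w x = 1) :
    cubeMean w (fun _ : Fin N → ℝ => 1) = 1 := by
  unfold cubeMean
  simp only [mul_one]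
  rw [integral_cube_prod fun _ => w]
  simp [hw1]

lemma cubeMean_apply (hw1 : ∫ x in Set.Icc (-Real.pi) Real.pi, w x = 1)
    (u : ℝ → ℝ) (j : Fin N) :
    cubeMean w (fun φ => u (φ j)) = ∫ x in Set.Icc (-Real.pi) Real.pi, w x * u x := by
  have h : ∀ φ : Fin N → ℝ, (∏ i, w (φ i)) * u (φ j)
      = ∏ i, (w (φ i) * if i = j then u (φ i) else 1) := by
    intro φ
    rw [Finset.prod_mul_distrib, Finset.prod_ite_eq' Finset.univ j fun i => u (φ i)]
    simp
  unfold cubeMean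
  simp only [h]
  rw [integral_cube_prod fun i x => w x * if i = j then u x else 1,
    Finset.prod_eq_single j]
  · simp
  · intro i _ hij
    simp [hij, hw1]
  · simp

lemma cubeMean_mul_apply (hw1 : ∫ x in Set.Icc (-Real.pi) Real.pi, w x = 1)
    (u v : ℝ → ℝ) {j k : Fin N} (hjk : j ≠ k) :
    cubeMean w (fun φ => u (φ j) * v (φ k))
      = (∫ x in Set.Icc (-Real.pi) Real.pi, w x * u x)
        * ∫ x in Set.Icc (-Real.pi) Real.pi, w x * v x := by
  have h : ∀ φ : Fin N → ℝ, (∏ i, w (φ i)) * (u (φ j) * v (φ k))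
      = ∏ i, (w (φ i) * ((if i = j then u (φ i) else 1) * if i = k then v (φ i) else 1)) := by
    intro φ
    rw [Finset.prod_mul_distrib, Finset.prod_mul_distrib,
      Finset.prod_ite_eq' Finset.univ j fun i => u (φ i),
      Finset.prod_ite_eq' Finset.univ k fun i => v (φ i)]
    simp
  unfold cubeMean
  simp only [h]
  rw [integral_cube_prod fun i x => w x * ((if i = j then u x else 1) * if i = k then v x else 1),
    Finset.prod_eq_mul j k hjk]
  · simp [hjk, hjk.symm]
  · intro i _ hij
    simp [hij.1, hij.2, hw1]
  · simp
  · simp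

/-- Distinct coordinates are independent, so the mean of cos n(φ_j - φ_k) is the sum of the squared
moments of `w`. -/
lemma cubeMean_logKernel (hw1 : ∫ x in Set.Icc (-Real.pi) Real.pi, w x = 1)
    (hw : Continuous w) (r : ℝ) (K : ℕ) {j k : Fin N} (hjk : j ≠ k) :
    cubeMean w (fun φ => logKernel r K (φ j - φ k))
      = 2 * ∑ n ∈ Finset.range K, r ^ (n + 1) *
        (((∫ x in Set.Icc (-Real.pi) Real.pi, w x * Real.cos (((n : ℝ) + 1) * x)) ^ 2
        + (∫ x in Set.Icc (-Real.pi) Real.pi, w x * Real.sin (((n : ℝ) + 1) * x)) ^ 2)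
          / ((n : ℝ) + 1)) := by
  unfold logKernel
  rw [cubeMean_const_mul, cubeMean_sum hw _ fun n => by fun_prop]
  congr 1
  refine Finset.sum_congr rfl fun n _ => ?_
  have h : ∀ φ : Fin N → ℝ, r ^ (n + 1) * Real.cos (((n : ℝ) + 1) * (φ j - φ k)) / ((n : ℝ) + 1)
      = r ^ (n + 1) / ((n : ℝ) + 1) *
        (Real.cos (((n : ℝ) + 1) * φ j) * Real.cos (((n : ℝ) + 1) * φ k)
        + Real.sin (((n : ℝ) + 1) * φ j) * Real.sin (((n : ℝ) + 1) * φ k)) := by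
    intro φ
    rw [mul_sub, Real.cos_sub]; ring
  simp only [h]
  rw [cubeMean_const_mul, cubeMean_add hw (by fun_prop) (by fun_prop),
    cubeMean_mul_apply hw1 (fun x => Real.cos (((n : ℝ) + 1) * x))
      (fun x => Real.cos (((n : ℝ) + 1) * x)) hjk,
    cubeMean_mul_apply hw1 (fun x => Real.sin (((n : ℝ) + 1) * x))
      (fun x => Real.sin (((n : ℝ) + 1) * x)) hjk]
  ring

/-- Jensen's inequality for the exponential function. -/
lemma exp_cubeMean_le (hw1 : ∫ x in Set.Icc (-Real.pi) Real.pi, w x = 1)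
    (hw : Continuous w) (hw0 : ∀ x, 0 < w x) {X G : (Fin N → ℝ) → ℝ}
    (hX : Continuous X) (hG : Continuous G) (h : ∀ φ, (∏ i, w (φ i)) * Real.exp (X φ) ≤ G φ) :
    Real.exp (cubeMean w X) ≤
      ∫ φ in Set.Icc (fun _ : Fin N => -Real.pi) (fun _ : Fin N => Real.pi), G φ := by
  set m := cubeMean w X with hm
  -- The tangent line of exp at the mean m has expectation e^m and lies below exp.
  have h1 : cubeMean w (fun φ => Real.exp m * (X φ + (1 - m) * 1)) = Real.exp m := by
    rw [cubeMean_const_mul, cubeMean_add hw hX (by fun_prop), cubeMean_const_mul,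
      cubeMean_one hw1, ← hm]
    ring
  rw [← h1]
  refine setIntegral_mono (integrableOn_cubeMean hw (by fun_prop)) (integrableOn_cube hG)
    fun φ => (mul_le_mul_of_nonneg_left ?_ (Finset.prod_nonneg fun i _ => (hw0 _).le)).trans (h φ)
  have := mul_le_mul_of_nonneg_left (Real.add_one_le_exp (X φ - m)) (Real.exp_pos m).le
  rw [← Real.exp_add] at this
  convert this using 2 <;> ring

end CubeMean

/-! ### The lower bound by a trial density. -/

section Lower

variable {w V : ℝ → ℝ} {E : ℝ}

/-- Dividing the integrand by the product density and applying Jensen gives interaction energy of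
order N² and entropy of order N. Taking r < 1 avoids the logarithmic singularity, and the bound does
not depend on r. -/
lemma exp_le_integral_gibbsWeight_of_lt (hw : Continuous w) (hw0 : ∀ x, 0 < w x)
    (hw1 : ∫ x in Set.Icc (-Real.pi) Real.pi, w x = 1) (hV : Continuous V)
    (hE : ∀ K : ℕ, ∑ n ∈ Finset.range K,
      ((∫ x in Set.Icc (-Real.pi) Real.pi, w x * Real.cos (((n : ℝ) + 1) * x)) ^ 2
        + (∫ x in Set.Icc (-Real.pi) Real.pi, w x * Real.sin (((n : ℝ) + 1) * x)) ^ 2)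
          / ((n : ℝ) + 1) ≤ E) (N : ℕ) (β : ℝ) {r η : ℝ} (hr0 : 0 < r) (hr : r < 1)
    (hη : 0 < η) :
    Real.exp (-((N : ℝ) ^ 2 * (E + η)) + N * (β * (∫ x in Set.Icc (-Real.pi) Real.pi, w x * V x)
        - ∫ x in Set.Icc (-Real.pi) Real.pi, w x * Real.log (2 * Real.pi * w x)))
      ≤ ∫ φ in Set.Icc (fun _ : Fin N => -Real.pi) (fun _ : Fin N => Real.pi),
        gibbsWeight N V β r φ * (1 / (2 * Real.pi)) ^ N := by
  have hpi : 0 < 2 * Real.pi := by positivity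
  obtain ⟨K, hK⟩ := exists_abs_log_add_logKernel_le hr0 hr hη
  replace hK := hK K le_rfl
  obtain ⟨L, hL⟩ : ∃ L : ℝ → ℝ, ∀ x, L x = Real.log (2 * Real.pi * w x) := ⟨_, fun _ => rfl⟩
  simp only [← hL]
  have hlog : Continuous L := by
    rw [funext hL]
    exact Continuous.log (by fun_prop) fun x => (mul_pos hpi (hw0 x)).ne'
  have hker : Continuous (logKernel r K) := by unfold logKernel; fun_prop
  set X : (Fin N → ℝ) → ℝ := fun φ =>
    (-1) * (∑ j, ∑ k ∈ Finset.Ioi j, (logKernel r K (φ j - φ k) + η * 1))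
      + ∑ j, (β * V (φ j) + (-1) * L (φ j)) with hX
  have hXc : Continuous X := by rw [hX]; fun_prop
  have hbound : ∀ φ, (∏ i, w (φ i)) * Real.exp (X φ)
      ≤ gibbsWeight N V β r φ * (1 / (2 * Real.pi)) ^ N := by
    intro φ
    have hpair : ∀ a b : ℝ, Real.exp (-(logKernel r K (a - b) + η))
        ≤ ‖Complex.exp (Complex.I * a) - r * Complex.exp (Complex.I * b)‖ ^ 2 := by
      intro a b
      rw [← Real.le_log_iff_exp_le (norm_exp_sub_mul_exp_sq_pos hr0 hr a b)]
      linarith [(abs_le.1 (hK a b)).1]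
    have hprod : Real.exp (∑ j, ∑ k ∈ Finset.Ioi j, -(logKernel r K (φ j - φ k) + η))
        ≤ ∏ j : Fin N, ∏ k ∈ Finset.Ioi j,
      ‖Complex.exp (Complex.I * (φ j : ℂ)) - r * Complex.exp (Complex.I * (φ k : ℂ))‖ ^ 2 := by
      rw [Real.exp_sum]
      refine Finset.prod_le_prod (fun _ _ => (Real.exp_pos _).le) fun j _ => ?_
      rw [Real.exp_sum]
      exact Finset.prod_le_prod (fun _ _ => (Real.exp_pos _).le) fun k _ => hpair _ _
    have hw2 : (∏ i, w (φ i)) * Real.exp (-∑ j, L (φ j))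
        = (1 / (2 * Real.pi)) ^ N := by
      rw [Real.exp_neg, Real.exp_sum, ← Finset.prod_inv_distrib, ← Finset.prod_mul_distrib]
      have : ∀ i, w (φ i) * (Real.exp (L (φ i)))⁻¹
          = 1 / (2 * Real.pi) := by
        intro i
        have := (hw0 (φ i)).ne'
        rw [hL, Real.exp_log (mul_pos hpi (hw0 _))]
        field_simp
      simp [this]
    have hXe : X φ = ∑ j, ∑ k ∈ Finset.Ioi j, -(logKernel r K (φ j - φ k) + η)
        + (β * ∑ j, V (φ j) + -∑ j, L (φ j)) := by
      simp only [hX, Finset.sum_add_distrib, Finset.sum_neg_distrib, Finset.mul_sum, mul_one]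
      simp
    unfold gibbsWeight
    rw [hXe, Real.exp_add, Real.exp_add, ← hw2]
    have hP : 0 ≤ ∏ i, w (φ i) := Finset.prod_nonneg fun i _ => (hw0 _).le
    calc _ = Real.exp (∑ j, ∑ k ∈ Finset.Ioi j, -(logKernel r K (φ j - φ k) + η))
          * Real.exp (β * ∑ j, V (φ j))
          * ((∏ i, w (φ i)) * Real.exp (-∑ j, L (φ j))) := by ring
      _ ≤ _ := by gcongr
  have hGc : Continuous fun φ => gibbsWeight N V β r φ * (1 / (2 * Real.pi)) ^ N :=
    ((continuous_gibbsWeight N hV β).uncurry_left r).mul continuous_const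
  refine le_trans (Real.exp_le_exp.2 ?_) (exp_cubeMean_le hw1 hw hw0 hXc hGc hbound)
  set e : ℕ → ℝ := fun n =>
      ((∫ x in Set.Icc (-Real.pi) Real.pi, w x * Real.cos (((n : ℝ) + 1) * x)) ^ 2
        + (∫ x in Set.Icc (-Real.pi) Real.pi, w x * Real.sin (((n : ℝ) + 1) * x)) ^ 2)
          / ((n : ℝ) + 1) with he
  have he0 : ∀ n, 0 ≤ e n := fun n => by simp only [he]; positivity
  have hEr : ∑ n ∈ Finset.range K, r ^ (n + 1) * e n ≤ E :=
    (Finset.sum_le_sum fun n _ =>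
      mul_le_of_le_one_left (he0 n) (pow_le_one₀ hr0.le hr.le)).trans (hE K)
  have hEr0 : 0 ≤ ∑ n ∈ Finset.range K, r ^ (n + 1) * e n :=
    Finset.sum_nonneg fun n _ => mul_nonneg (by positivity) (he0 n)
  have hmean : cubeMean w X = (-1) * (∑ j : Fin N, ∑ k ∈ Finset.Ioi j,
      (2 * (∑ n ∈ Finset.range K, r ^ (n + 1) * e n) + η))
      + N * (β * (∫ x in Set.Icc (-Real.pi) Real.pi, w x * V x)
        - ∫ x in Set.Icc (-Real.pi) Real.pi, w x * L x) := by
    rw [hX, cubeMean_add hw (by fun_prop) (by fun_prop), cubeMean_const_mul,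
      cubeMean_sum hw _ fun j => by fun_prop, cubeMean_sum hw _ fun j => by fun_prop]
    congr 1
    · congr 1
      refine Finset.sum_congr rfl fun j _ => ?_
      rw [cubeMean_sum hw _ fun k => by fun_prop]
      refine Finset.sum_congr rfl fun k hk => ?_
      rw [cubeMean_add hw (by fun_prop) (by fun_prop), cubeMean_const_mul, cubeMean_one hw1,
        cubeMean_logKernel hw1 hw r K (Finset.mem_Ioi.1 hk).ne, mul_one]
    · have : ∀ j : Fin N, cubeMean w
          (fun φ : Fin N → ℝ => β * V (φ j) + (-1) * L (φ j))
          = β * (∫ x in Set.Icc (-Real.pi) Real.pi, w x * V x)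
        - ∫ x in Set.Icc (-Real.pi) Real.pi, w x * L x := by
        intro j
        rw [cubeMean_add hw (by fun_prop) (by fun_prop), cubeMean_const_mul, cubeMean_const_mul,
          cubeMean_apply hw1 V j, cubeMean_apply hw1 L j]
        ring
      rw [Finset.sum_congr rfl fun j _ => this j]
      simp [mul_sub]
  rw [hmean]
  have hcount := sum_sum_Ioi_eq (N := N) (fun _ _ =>
    2 * (∑ n ∈ Finset.range K, r ^ (n + 1) * e n) + η) fun _ _ => rfl
  simp only [Finset.sum_const, Finset.card_univ, Fintype.card_fin, nsmul_eq_mul] at hcount ⊢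
  have hN : (0 : ℝ) ≤ N := by positivity
  have h2 : (N : ℝ) ^ 2 * (∑ n ∈ Finset.range K, r ^ (n + 1) * e n) ≤ (N : ℝ) ^ 2 * E := by gcongr
  have h3 : 0 ≤ (N : ℝ) * (2 * (∑ n ∈ Finset.range K, r ^ (n + 1) * e n) + η) := by positivity
  have h4 : 0 ≤ (N : ℝ) ^ 2 * η := by positivity
  nlinarith

/-- The lower bound for the partition function by a trial density. -/
theorem exp_le_partitionFunction (hw : Continuous w) (hw0 : ∀ x, 0 < w x)
    (hw1 : ∫ x in Set.Icc (-Real.pi) Real.pi, w x = 1) (hV : Continuous V)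
    (hE : ∀ K : ℕ, ∑ n ∈ Finset.range K,
      ((∫ x in Set.Icc (-Real.pi) Real.pi, w x * Real.cos (((n : ℝ) + 1) * x)) ^ 2
        + (∫ x in Set.Icc (-Real.pi) Real.pi, w x * Real.sin (((n : ℝ) + 1) * x)) ^ 2)
          / ((n : ℝ) + 1) ≤ E) (N : ℕ) (β : ℝ) {η : ℝ} (hη : 0 < η) :
    Real.exp (-((N : ℝ) ^ 2 * (E + η)) + N * (β * (∫ x in Set.Icc (-Real.pi) Real.pi, w x * V x)
        - (∫ x in Set.Icc (-Real.pi) Real.pi, w x * Real.log (2 * Real.pi * w x)) - Real.log N))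
      ≤ partitionFunction N V β := by
  -- The integrand is polynomial in r even where points collide, so the bound passes to r = 1
  -- without any analysis of the singular kernel.
  have hcont : Continuous fun r : ℝ =>
      ∫ φ in Set.Icc (fun _ : Fin N => -Real.pi) (fun _ : Fin N => Real.pi),
        gibbsWeight N V β r φ * (1 / (2 * Real.pi)) ^ N := by
    refine continuous_parametric_integral_of_continuous ?_ isCompact_Icc
    exact (continuous_gibbsWeight N hV β).mul continuous_const
  have h1 := ge_of_tendsto (hcont.tendsto 1 |>.mono_left (nhdsWithin_le_nhds (s := Set.Iio 1)))
    (b := Real.exp (-((N : ℝ) ^ 2 * (E + η)) +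
      N * (β * (∫ x in Set.Icc (-Real.pi) Real.pi, w x * V x)
        - ∫ x in Set.Icc (-Real.pi) Real.pi, w x * Real.log (2 * Real.pi * w x)))) (by
    have hev : ∀ᶠ r : ℝ in 𝓝[<] 1, 0 < r := nhdsWithin_le_nhds (lt_mem_nhds one_pos)
    filter_upwards [hev, self_mem_nhdsWithin] with r hr0 hr
    exact exp_le_integral_gibbsWeight_of_lt hw hw0 hw1 hV hE N β hr0 hr hη)
  have hf : Real.exp (-(N * Real.log N)) ≤ 1 / (N.factorial : ℝ) := by
    rw [Real.exp_neg, ← one_div]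
    refine one_div_le_one_div_of_le (by positivity) ?_
    rcases Nat.eq_zero_or_pos N with rfl | hN
    · simp
    · rw [mul_comm, Real.exp_mul, Real.exp_log (by exact_mod_cast hN), Real.rpow_natCast]
      exact_mod_cast N.factorial_le_pow
  rw [partitionFunction_eq, ← integral_mul_const]
  have h2 : -((N : ℝ) ^ 2 * (E + η)) + N * (β * (∫ x in Set.Icc (-Real.pi) Real.pi, w x * V x)
        - (∫ x in Set.Icc (-Real.pi) Real.pi, w x * Real.log (2 * Real.pi * w x)) - Real.log N)
      = -(N * Real.log N) + (-((N : ℝ) ^ 2 * (E + η)) +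
      N * (β * (∫ x in Set.Icc (-Real.pi) Real.pi, w x * V x)
        - ∫ x in Set.Icc (-Real.pi) Real.pi, w x * Real.log (2 * Real.pi * w x))) := by ring
  rw [h2, Real.exp_add]
  exact mul_le_mul hf h1 (Real.exp_pos _).le (by positivity)

end Lower

/-! ### The critical coupling and the sign of the full-support density. -/

section Coupling

variable {g g' : ℕ → ℝ} {γ : ℝ}

/-- Inversion turns γ ≤ (-2m)⁻¹ into -2m ≤ 1/γ. `EReal.toENNReal` sends nonpositive values of -2m to
0, whose inverse is ∞, so the case m ≥ 0 fits the same formula. -/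
lemma ofReal_le_criticalCoupling_iff (hγ : 0 < γ) :
    ENNReal.ofReal γ ≤ criticalCoupling g g' ↔
      ∀ φ ∈ Set.Ioc (-Real.pi) Real.pi, ((-(1 / (2 * γ)) : ℝ) : EReal) ≤ trigSum g g' φ := by
  unfold criticalCoupling
  rw [ENNReal.le_inv_iff_le_inv, ← ENNReal.ofReal_inv_of_pos hγ, ← le_iInf₂_iff]
  induction ⨅ φ ∈ Set.Ioc (-Real.pi) Real.pi, trigSum g g' φ using EReal.rec with
  | bot =>
    rw [EReal.coe_mul_bot_of_neg (by norm_num), EReal.toENNReal_top, top_le_iff, le_bot_iff]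
    exact iff_of_false ENNReal.ofReal_ne_top (EReal.coe_ne_bot _)
  | top =>
    rw [EReal.coe_mul_top_of_neg (by norm_num), EReal.toENNReal_bot]
    simp
  | coe m =>
    rw [← EReal.coe_mul, EReal.real_coe_toENNReal,
      ENNReal.ofReal_le_ofReal_iff (by positivity), EReal.coe_le_coe_iff, one_div, mul_inv]
    constructor <;> intro h <;> linarith

lemma zero_le_fullDensity_iff (hγ : 0 < γ) (φ : ℝ) :
    0 ≤ fullDensity g g' γ φ ↔ ((-(1 / (2 * γ)) : ℝ) : EReal) ≤ trigSum g g' φ := by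
  unfold fullDensity
  have hpi : 0 < 1 / (2 * Real.pi) := by positivity
  induction trigSum g g' φ using EReal.rec with
  | bot =>
    rw [EReal.coe_mul_bot_of_pos (by positivity), EReal.add_bot, EReal.coe_mul_bot_of_pos hpi]
    exact iff_of_false (by simp) (by rw [le_bot_iff]; exact EReal.coe_ne_bot _)
  | top =>
    rw [EReal.coe_mul_top_of_pos (by positivity), EReal.add_top_of_ne_bot (show (1 : EReal) ≠ ⊥ from EReal.coe_ne_bot 1),
      EReal.coe_mul_top_of_pos hpi]
    simp
  | coe s =>
    rw [← EReal.coe_mul, ← EReal.coe_one, ← EReal.coe_add, ← EReal.coe_mul, ← EReal.coe_zero,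
      EReal.coe_le_coe_iff, EReal.coe_le_coe_iff, mul_nonneg_iff_of_pos_left hpi, neg_le,
      le_div_iff₀ (by positivity)]
    constructor <;> intro h <;> linarith

theorem ofReal_le_criticalCoupling_iff_fullDensity (hγ : 0 ≤ γ) :
    ENNReal.ofReal γ ≤ criticalCoupling g g' ↔
      ∀ φ ∈ Set.Ioc (-Real.pi) Real.pi, 0 ≤ fullDensity g g' γ φ := by
  rcases hγ.eq_or_lt with rfl | hγ
  · simp only [ENNReal.ofReal_zero, zero_le, true_iff]
    intro φ _
    unfold fullDensity
    rw [mul_zero, EReal.coe_zero, zero_mul, add_zero, mul_one, ← EReal.coe_zero,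
      EReal.coe_le_coe_iff]
    positivity
  · rw [ofReal_le_criticalCoupling_iff hγ]
    exact forall₂_congr fun φ _ => (zero_le_fullDensity_iff hγ φ).symm

lemma trigTerm_add_int_mul_two_pi (n : ℕ) (x : ℝ) (k : ℤ) :
    trigTerm g g' n (x + k * (2 * Real.pi)) = trigTerm g g' n x := by
  unfold trigTerm
  have : (n : ℝ) * (x + k * (2 * Real.pi)) = n * x + ((n * k : ℤ) : ℝ) * (2 * Real.pi) := by
    push_cast; ring
  rw [this, Real.cos_add_int_mul_two_pi, Real.sin_add_int_mul_two_pi]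

/-- Periodicity carries the bound from (-π, π] to the line. A lower limit controls the partial sums
eventually only below its value, hence the strict inequality on `d`. -/
lemma eventually_le_sum_trigTerm (hγ : 0 < γ) (h : ENNReal.ofReal γ ≤ criticalCoupling g g')
    (x d : ℝ) (hd : 1 / (2 * γ) < d) :
    ∀ᶠ K : ℕ in atTop, -d ≤ ∑ n ∈ Finset.Icc 1 K, trigTerm g g' n x := by
  obtain ⟨k, hk, -⟩ := existsUnique_add_zsmul_mem_Ioc Real.two_pi_pos x (-Real.pi)
  rw [show -Real.pi + 2 * Real.pi = Real.pi by ring, zsmul_eq_mul] at hk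
  have h1 := (ofReal_le_criticalCoupling_iff hγ).1 h _ hk
  have h2 : ((-d : ℝ) : EReal) < trigSum g g' (x + k * (2 * Real.pi)) :=
    lt_of_lt_of_le (EReal.coe_lt_coe_iff.2 (neg_lt_neg hd)) h1
  unfold trigSum at h2
  filter_upwards [eventually_lt_of_lt_liminf h2] with K hK
  have hK' := (EReal.coe_lt_coe_iff.1 hK).le
  refine hK'.trans (le_of_eq (Finset.sum_congr rfl fun n _ => ?_))
  exact trigTerm_add_int_mul_two_pi n x k

end Coupling

/-! ### Consequences of the decay of the coefficients. -/

section Decay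

variable {g g' : ℕ → ℝ}

lemma exists_abs_le_of_isBigO {ε : ℝ} (h : g =O[atTop] fun n : ℕ => (n : ℝ) ^ (-ε)) :
    ∃ C, 0 ≤ C ∧ ∀ n : ℕ, |g (n + 1)| ≤ C * ((n : ℝ) + 1) ^ (-ε) := by
  have h1 := h.comp_tendsto (tendsto_add_atTop_nat 1)
  obtain ⟨C, hC, hb⟩ := Asymptotics.bound_of_isBigO_nat_atTop h1
  refine ⟨C, hC.le, fun n => ?_⟩
  have hp : (0 : ℝ) < ((n : ℝ) + 1) ^ (-ε) := by positivity
  have := hb (x := n) (by simpa using hp.ne')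
  simpa [abs_of_pos hp] using this

lemma CoeffDecay.summableCoeff (hd : CoeffDecay g g') :
    SummableCoeff g g' ∧ ∃ B, (∀ n, |g (n + 1)| ≤ B) ∧ ∀ n, |g' (n + 1)| ≤ B := by
  obtain ⟨ε, hε, h1, h2⟩ := hd
  obtain ⟨C, hC, hg⟩ := exists_abs_le_of_isBigO h1
  obtain ⟨C', hC', hg'⟩ := exists_abs_le_of_isBigO h2
  have hsum : Summable fun n : ℕ => ((n : ℝ) + 1) ^ (-ε) / ((n : ℝ) + 1) := by
    have := (summable_nat_add_iff 1).2 (Real.summable_one_div_nat_rpow.2 (by linarith : 1 < 1 + ε))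
    refine this.congr fun n => ?_
    push_cast
    rw [Real.rpow_neg (by positivity), Real.rpow_add (by positivity), Real.rpow_one]
    field_simp
  have hle1 : ∀ n : ℕ, ((n : ℝ) + 1) ^ (-ε) ≤ 1 := fun n =>
    Real.rpow_le_one_of_one_le_of_nonpos (by linarith [Nat.cast_nonneg (α := ℝ) n]) (by linarith)
  refine ⟨Summable.of_nonneg_of_le (fun n => by positivity) (fun n => ?_)
    (hsum.mul_left (C + C')), max C C', fun n => ?_, fun n => ?_⟩
  · rw [← mul_div_assoc]
    gcongr
    linarith [hg n, hg' n]
  · exact (hg n).trans ((mul_le_of_le_one_right hC (hle1 n)).trans (le_max_left _ _))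
  · exact (hg' n).trans ((mul_le_of_le_one_right hC' (hle1 n)).trans (le_max_right _ _))

lemma SummableCoeff.summable_sq (hs : SummableCoeff g g') {B : ℝ} (hg : ∀ n, |g (n + 1)| ≤ B)
    (hg' : ∀ n, |g' (n + 1)| ≤ B) :
    Summable fun n : ℕ => (g (n + 1) ^ 2 + g' (n + 1) ^ 2) / ((n : ℝ) + 1) := by
  refine Summable.of_nonneg_of_le (fun n => by positivity) (fun n => ?_) (hs.mul_left B)
  rw [← mul_div_assoc]
  gcongr
  rw [← sq_abs (g (n + 1)), ← sq_abs (g' (n + 1))]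
  nlinarith [mul_le_mul_of_nonneg_right (hg n) (abs_nonneg (g (n + 1))),
    mul_le_mul_of_nonneg_right (hg' n) (abs_nonneg (g' (n + 1)))]

end Decay

/-! ### The smoothed density and the limit of the free energy. -/

section FreeEnergy

variable {g g' : ℕ → ℝ} {γ B : ℝ}

/-- The lower bound given by a positive density whose Fourier coefficients are those of the
full-support density multiplied by `s n`. -/
lemma SummableCoeff.exists_exp_le_partitionFunction (hs : SummableCoeff g g')
    (hg : ∀ n, |g (n + 1)| ≤ B) (hg' : ∀ n, |g' (n + 1)| ≤ B) (h : ℝ) {s : ℕ → ℝ}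
    (hs0 : ∀ n, 0 ≤ s n) (hs1 : ∀ n, s n ≤ 1) (hss : Summable s)
    (hpos : ∀ x, 0 < 1 + 2 * ∑' n : ℕ, γ * s n * trigTerm g g' (n + 1) x) {η : ℝ} (hη : 0 < η) :
    ∃ H : ℝ, ∀ N : ℕ, Real.exp ((N : ℝ) ^ 2 * (γ * h + γ ^ 2 *
        (∑' n : ℕ, (2 * s n - s n ^ 2) * ((g (n + 1) ^ 2 + g' (n + 1) ^ 2) / ((n : ℝ) + 1))) - η)
        - N * (H + Real.log N)) ≤ partitionFunction N (potential h g g') (γ * N) := by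
  have hq := hs.summable_sq hg hg'
  set q : ℕ → ℝ := fun n => (g (n + 1) ^ 2 + g' (n + 1) ^ 2) / ((n : ℝ) + 1) with hqdef
  have hq0 : ∀ n, 0 ≤ q n := fun n => by simp only [hqdef]; positivity
  have hB : 0 ≤ B := (abs_nonneg _).trans (hg 0)
  -- The trial density is itself 1/(2π) times a `potential`, so its Fourier formulas can be reused:
  -- the factor n cancels the division by n there, and the shift is due to `s` being indexed from 0.
  set G : ℕ → ℝ := fun n => γ * n * s (n - 1) * g n with hG
  set G' : ℕ → ℝ := fun n => γ * n * s (n - 1) * g' n with hG'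
  have eG : ∀ n : ℕ, G (n + 1) / ((n : ℝ) + 1) = γ * s n * g (n + 1) := fun n => by
    simp only [hG, Nat.add_sub_cancel]; push_cast; field_simp
  have eG' : ∀ n : ℕ, G' (n + 1) / ((n : ℝ) + 1) = γ * s n * g' (n + 1) := fun n => by
    simp only [hG', Nat.add_sub_cancel]; push_cast; field_simp
  have hsG : SummableCoeff G G' := by
    refine Summable.of_nonneg_of_le (fun n => by positivity) (fun n => ?_)
      (hss.mul_left (|γ| * (2 * B)))
    have hn : (0 : ℝ) < (n : ℝ) + 1 := by positivity
    have e : (|G (n + 1)| + |G' (n + 1)|) / ((n : ℝ) + 1)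
        = |γ| * (|g (n + 1)| + |g' (n + 1)|) * s n := by
      have ha : ∀ x : ℝ, |x| / ((n : ℝ) + 1) = |x / ((n : ℝ) + 1)| := fun x => by
        rw [abs_div, abs_of_pos hn]
      rw [add_div, ha, ha, eG, eG', abs_mul, abs_mul, abs_mul, abs_mul,
        abs_of_nonneg (hs0 n)]
      ring
    rw [e]
    have := hs0 n
    gcongr
    linarith [hg n, hg' n]
  have hfpos : ∀ x, 0 < potential 1 G G' x := fun x => by
    rw [potential_eq_trigTerm]
    refine (hpos x).trans_eq ?_
    congr 3; funext n
    have : trigTerm G G' (n + 1) x / ((n : ℝ) + 1)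
        = G (n + 1) / ((n : ℝ) + 1) * Real.cos ((n + 1 : ℕ) * x)
          + G' (n + 1) / ((n : ℝ) + 1) * Real.sin ((n + 1 : ℕ) * x) := by
      unfold trigTerm; ring
    rw [this, eG, eG']
    unfold trigTerm; ring
  have hpi : 0 < 2 * Real.pi := by positivity
  set w : ℝ → ℝ := fun x => 1 / (2 * Real.pi) * potential 1 G G' x with hw
  have hwc : Continuous w := continuous_const.mul (hsG.continuous_potential 1)
  have hw0 : ∀ x, 0 < w x := fun x => mul_pos (by positivity) (hfpos x)
  have hw1 : ∫ x in Set.Icc (-Real.pi) Real.pi, w x = 1 := by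
    simp only [hw]
    rw [integral_const_mul, hsG.integral_potential]
    field_simp
  have hcos : ∀ n : ℕ, ∫ x in Set.Icc (-Real.pi) Real.pi, w x * Real.cos (((n : ℝ) + 1) * x)
      = γ * s n * g (n + 1) := fun n => by
    simp only [hw, mul_assoc]
    rw [integral_const_mul, hsG.integral_potential_mul_cos, eG]
    field_simp
  have hsin : ∀ n : ℕ, ∫ x in Set.Icc (-Real.pi) Real.pi, w x * Real.sin (((n : ℝ) + 1) * x)
      = γ * s n * g' (n + 1) := fun n => by
    simp only [hw, mul_assoc]
    rw [integral_const_mul, hsG.integral_potential_mul_sin, eG']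
    field_simp
  have hsq : Summable fun n => s n ^ 2 * q n :=
    Summable.of_nonneg_of_le (fun n => mul_nonneg (sq_nonneg _) (hq0 n))
      (fun n => mul_le_of_le_one_left (hq0 n) (pow_le_one₀ (hs0 n) (hs1 n))) hq
  have hsq1 : Summable fun n => s n * q n :=
    Summable.of_nonneg_of_le (fun n => mul_nonneg (hs0 n) (hq0 n))
      (fun n => mul_le_of_le_one_left (hq0 n) (hs1 n)) hq
  have hE : ∀ K : ℕ, ∑ n ∈ Finset.range K,
      ((∫ x in Set.Icc (-Real.pi) Real.pi, w x * Real.cos (((n : ℝ) + 1) * x)) ^ 2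
        + (∫ x in Set.Icc (-Real.pi) Real.pi, w x * Real.sin (((n : ℝ) + 1) * x)) ^ 2)
          / ((n : ℝ) + 1) ≤ γ ^ 2 * ∑' n, s n ^ 2 * q n := fun K => by
    refine le_trans (le_of_eq ?_) (mul_le_mul_of_nonneg_left
      (hsq.sum_le_tsum (Finset.range K) fun n _ => mul_nonneg (sq_nonneg _) (hq0 n)) (sq_nonneg γ))
    rw [Finset.mul_sum]
    refine Finset.sum_congr rfl fun n _ => ?_
    rw [hcos, hsin]
    simp only [hqdef]
    ring
  have hVw : ∫ x in Set.Icc (-Real.pi) Real.pi, w x * potential h g g' x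
      = h + 2 * γ * ∑' n, s n * q n := by
    have h1 := hs.hasSum_integral_potential_mul h hwc
    rw [hw1] at h1
    simp only [mul_comm _ (w _), hcos, hsin] at h1
    have h2 := h1.unique ((hsq1.hasSum.mul_left (2 * γ)).congr_fun fun n => by
      simp only [hqdef]; ring)
    linarith
  refine ⟨∫ x in Set.Icc (-Real.pi) Real.pi, w x * Real.log (2 * Real.pi * w x), fun N => ?_⟩
  refine le_trans (le_of_eq ?_) (exp_le_partitionFunction hwc hw0 hw1 (hs.continuous_potential h)
    hE N (γ * N) hη)
  -- The potential contributes 2s and the interaction energy -s²; the result is stationary at s = 1.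
  have hsplit : ∑' n, (2 * s n - s n ^ 2) * q n = 2 * (∑' n, s n * q n) - ∑' n, s n ^ 2 * q n := by
    rw [← tsum_mul_left, ← (hsq1.mul_left 2).tsum_sub hsq]
    congr 1; funext n; ring
  rw [hVw, hsplit]
  congr 1
  ring

/-- Below the critical coupling, the partition function is bounded below by the Szegő value. -/
lemma SummableCoeff.exists_exp_le_partitionFunction_of_le_criticalCoupling
    (hs : SummableCoeff g g') (hg : ∀ n, |g (n + 1)| ≤ B) (hg' : ∀ n, |g' (n + 1)| ≤ B) (h : ℝ)
    (hγ : 0 ≤ γ) (hγc : ENNReal.ofReal γ ≤ criticalCoupling g g') {δ : ℝ} (hδ : 0 < δ) :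
    ∃ H : ℝ, ∀ N : ℕ, Real.exp ((N : ℝ) ^ 2 * (γ * h + γ ^ 2 *
        (∑' n : ℕ, (g (n + 1) ^ 2 + g' (n + 1) ^ 2) / ((n : ℝ) + 1)) - δ)
        - N * (H + Real.log N)) ≤ partitionFunction N (potential h g g') (γ * N) := by
  have hq := hs.summable_sq hg hg'
  set q : ℕ → ℝ := fun n => (g (n + 1) ^ 2 + g' (n + 1) ^ 2) / ((n : ℝ) + 1) with hqdef
  have hq0 : ∀ n, 0 ≤ q n := fun n => by simp only [hqdef]; positivity
  -- The means only make the smoothed density nonnegative at γ = γ_c; the factor 1 - τ leaves 1 -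
  -- (1-τ) = τ > 0.
  set s : ℝ → ℕ → ℝ := fun τ n => (1 - τ) * (1 / (1 + (τ * ((n : ℝ) + 1)) ^ 2)) with hsdef
  have hs0 : ∀ τ, τ < 1 → ∀ n, 0 ≤ s τ n := fun τ hτ n =>
    mul_nonneg (by linarith) (by positivity)
  have hs1 : ∀ τ, 0 < τ → τ < 1 → ∀ n, s τ n ≤ 1 := fun τ h0 hτ n => by
    have : 1 / (1 + (τ * ((n : ℝ) + 1)) ^ 2) ≤ 1 := by
      rw [div_le_one (by positivity)]; nlinarith [sq_nonneg (τ * ((n : ℝ) + 1))]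
    have h2 : 0 ≤ 1 / (1 + (τ * ((n : ℝ) + 1)) ^ 2) := by positivity
    simp only [hsdef]
    nlinarith
  have hev : ∀ᶠ τ : ℝ in 𝓝[>] 0, 0 < τ ∧ τ < 1 := by
    filter_upwards [Ioo_mem_nhdsGT (zero_lt_one (α := ℝ))] with τ hτ using hτ
  -- Dominated convergence applies because 0 ≤ 2s - s² ≤ 1 for s in [0, 1].
  have hlim : Tendsto (fun τ : ℝ => ∑' n, (2 * s τ n - s τ n ^ 2) * q n) (𝓝[>] 0)
      (𝓝 (∑' n, q n)) := by
    refine tendsto_tsum_of_dominated_convergence hq (fun n => ?_) ?_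
    · have hc : ContinuousAt (fun τ : ℝ => (2 * s τ n - s τ n ^ 2) * q n) 0 := by
        simp only [hsdef]
        fun_prop (disch := norm_num)
      have := hc.tendsto.mono_left (nhdsWithin_le_nhds (s := Set.Ioi 0))
      convert this using 2
      simp [hsdef]
      ring
    · filter_upwards [hev] with τ hτ n
      have h0 := hs0 τ hτ.2 n
      have h1 := hs1 τ hτ.1 hτ.2 n
      rw [Real.norm_of_nonneg (mul_nonneg (by nlinarith) (hq0 n))]
      exact mul_le_of_le_one_left (hq0 n) (by nlinarith [sq_nonneg (1 - s τ n)])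
  have hlim2 := (hlim.const_mul (γ ^ 2)).eventually
    (lt_mem_nhds (by linarith : γ ^ 2 * (∑' n, q n) - δ / 2 < γ ^ 2 * ∑' n, q n))
  obtain ⟨τ, hτq, hτ0, hτ1⟩ := (hlim2.and hev).exists
  have hpos : ∀ x, 0 < 1 + 2 * ∑' n : ℕ, γ * s τ n * trigTerm g g' (n + 1) x := by
    intro x
    have e : ∑' n : ℕ, γ * s τ n * trigTerm g g' (n + 1) x
        = γ * (1 - τ) * resolventMean g g' τ x := by
      unfold resolventMean
      rw [← tsum_mul_left]
      congr 1; funext n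
      simp only [hsdef]; ring
    rw [e]
    rcases hγ.eq_or_lt with rfl | hγ
    · simp
    · have hM := neg_le_resolventMean hg hg' (by positivity : 0 ≤ 1 / (2 * γ))
        (eventually_le_sum_trigTerm hγ hγc) hτ0 x
      have h1 := mul_le_mul_of_nonneg_left hM
        (mul_nonneg hγ.le (by linarith) : 0 ≤ γ * (1 - τ))
      have h2 : γ * (1 - τ) * -(1 / (2 * γ)) = -(1 - τ) / 2 := by field_simp
      linarith
  obtain ⟨H, hH⟩ := hs.exists_exp_le_partitionFunction hg hg' h (hs0 τ hτ1) (hs1 τ hτ0 hτ1)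
    ((summable_resolvent hτ0).mul_left _) hpos (half_pos hδ)
  refine ⟨H, fun N => le_trans (Real.exp_le_exp.2 ?_) (hH N)⟩
  refine sub_le_sub_right (mul_le_mul_of_nonneg_left ?_ (by positivity)) _
  linarith

/-- The limit of the free energy below the critical coupling. -/
theorem CoeffDecay.tendsto_freeEnergy (hd : CoeffDecay g g') (h : ℝ) (hγ : 0 ≤ γ)
    (hγc : ENNReal.ofReal γ ≤ criticalCoupling g g') :
    Tendsto (fun N : ℕ => freeEnergy N (potential h g g') γ) atTop
      (𝓝 (γ * h + γ ^ 2 * ∑' n : ℕ, (g (n + 1) ^ 2 + g' (n + 1) ^ 2) / ((n : ℝ) + 1))) := by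
  obtain ⟨hs, B, hg, hg'⟩ := hd.summableCoeff
  set L := γ * h + γ ^ 2 * ∑' n : ℕ, (g (n + 1) ^ 2 + g' (n + 1) ^ 2) / ((n : ℝ) + 1) with hL
  rw [Metric.tendsto_nhds]
  intro ε hε
  obtain ⟨C, hC⟩ := hs.partitionFunction_le (hs.summable_sq hg hg') h hγ
    (by positivity : 0 < ε / 3)
  obtain ⟨H, hH⟩ := hs.exists_exp_le_partitionFunction_of_le_criticalCoupling hg hg' h hγ hγc
    (by positivity : 0 < ε / 3)
  have hinv : Tendsto (fun N : ℕ => (N : ℝ)⁻¹) atTop (𝓝 0) := tendsto_inv_atTop_nhds_zero_nat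
  have hlog : Tendsto (fun N : ℕ => Real.log N / N) atTop (𝓝 0) :=
    (Real.isLittleO_log_id_atTop.tendsto_div_nhds_zero).comp tendsto_natCast_atTop_atTop
  have h1 : ∀ᶠ N : ℕ in atTop, C * (N : ℝ)⁻¹ < ε / 3 := by
    have := hinv.const_mul C
    rw [mul_zero] at this
    exact this.eventually (gt_mem_nhds (by positivity))
  have h2 : ∀ᶠ N : ℕ in atTop, H * (N : ℝ)⁻¹ + Real.log N / N < ε / 3 := by
    have := (hinv.const_mul H).add hlog
    rw [mul_zero, zero_add] at this
    exact this.eventually (gt_mem_nhds (by positivity))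
  filter_upwards [h1, h2, eventually_ge_atTop 1] with N h1 h2 hN
  have hN0 : (0 : ℝ) < N := by exact_mod_cast hN
  have hZ : 0 < partitionFunction N (potential h g g') (γ * N) := (Real.exp_pos _).trans_le (hH N)
  have hup := (Real.log_le_iff_le_exp hZ).2 (hC N)
  have hlo := (Real.le_log_iff_exp_le hZ).2 (hH N)
  unfold freeEnergy
  rw [Real.dist_eq, abs_lt]
  have e1 : ((N : ℝ) ^ 2 * (L + ε / 3) + N * C) = (L + ε / 3 + C * (N : ℝ)⁻¹) * (N : ℝ) ^ 2 := by
    field_simp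
  have e2 : ((N : ℝ) ^ 2 * (L - ε / 3) - N * (H + Real.log N))
      = (L - ε / 3 - (H * (N : ℝ)⁻¹ + Real.log N / N)) * (N : ℝ) ^ 2 := by
    field_simp
  have hup' := (div_le_iff₀ (by positivity : (0 : ℝ) < (N : ℝ) ^ 2)).2 (hup.trans_eq e1)
  have hlo' := (le_div_iff₀ (by positivity : (0 : ℝ) < (N : ℝ) ^ 2)).2 (e2.symm.trans_le hlo)
  constructor <;> linarith

end FreeEnergy

/-! ### Exponential and polylogarithmic interactions. -/

section Examples

lemma coeffDecay_exp_div_zpow {p : ℤ} {α : ℝ} (hα : 0 < α ∨ (α = 0 ∧ 0 < p)) :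
    CoeffDecay (fun n => Real.exp (-(n * α)) / (n : ℝ) ^ p) (fun _ => 0) := by
  refine ⟨1, one_pos, ?_, Asymptotics.isBigO_zero _ _⟩
  rcases hα with hα | ⟨rfl, hp⟩
  · have h1 := ((isLittleO_exp_neg_mul_rpow_atTop hα ((p : ℝ) - 1)).isBigO).comp_tendsto
      tendsto_natCast_atTop_atTop
    have h2 := h1.mul (Asymptotics.isBigO_refl (fun n : ℕ => ((n : ℝ) ^ p)⁻¹) atTop)
    refine h2.congr' (Eventually.of_forall fun n => ?_) ?_
    · simp only [Function.comp_apply]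
      rw [div_eq_mul_inv]; ring_nf
    · filter_upwards [eventually_ge_atTop 1] with n hn
      have hn0 : (0 : ℝ) < n := by exact_mod_cast hn
      simp only [Function.comp_apply]
      rw [Real.rpow_sub hn0, Real.rpow_intCast, Real.rpow_neg hn0.le, Real.rpow_one]
      have : (n : ℝ) ^ p ≠ 0 := (zpow_pos hn0 p).ne'
      field_simp
  · refine Asymptotics.IsBigO.of_bound 1 ?_
    filter_upwards [eventually_ge_atTop 1] with n hn
    have hn1 : (1 : ℝ) ≤ n := by exact_mod_cast hn
    have hn0 : (0 : ℝ) < n := by linarith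
    rw [Real.rpow_neg hn0.le, Real.rpow_one, mul_zero, neg_zero, Real.exp_zero, one_mul,
      Real.norm_of_nonneg (by positivity), Real.norm_of_nonneg (by positivity), one_div]
    gcongr
    simpa using zpow_le_zpow_right₀ hn1 (by omega : 1 ≤ p)

theorem tendsto_freeEnergy_exp_div_zpow (h : ℝ) {p : ℤ} {α : ℝ} (hα : 0 < α ∨ (α = 0 ∧ 0 < p))
    {γ : ℝ} (hγ : 0 ≤ γ) (hγc : ENNReal.ofReal γ ≤
      criticalCoupling (fun n => Real.exp (-(n * α)) / (n : ℝ) ^ p) (fun _ => 0)) :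
    Tendsto (fun N : ℕ => freeEnergy N
        (potential h (fun n => Real.exp (-(n * α)) / (n : ℝ) ^ p) (fun _ => 0)) γ) atTop
      (𝓝 (γ * h + γ ^ 2 *
        ∑' n : ℕ, Real.exp (-(2 * ((n : ℝ) + 1) * α)) / ((n : ℝ) + 1) ^ (2 * p + 1))) := by
  have h1 := (coeffDecay_exp_div_zpow hα).tendsto_freeEnergy h hγ hγc
  convert h1 using 5
  funext n
  have hn : (0 : ℝ) < (n : ℝ) + 1 := by positivity
  push_cast
  rw [div_pow, ← Real.exp_nat_mul, zpow_add₀ hn.ne', zpow_one, mul_comm 2 p, zpow_mul]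
  norm_num
  rw [div_div]
  ring_nf

lemma tsum_exp_div {α : ℝ} (hα : 0 < α) :
    ∑' n : ℕ, Real.exp (-(2 * ((n : ℝ) + 1) * α)) / ((n : ℝ) + 1)
      = -Real.log (1 - Real.exp (-(2 * α))) := by
  have hlt : |Real.exp (-(2 * α))| < 1 := by
    rw [abs_of_pos (Real.exp_pos _), Real.exp_lt_one_iff]; linarith
  rw [← (Real.hasSum_pow_div_log_of_abs_lt_one hlt).tsum_eq]
  congr 1; funext n
  rw [← Real.exp_nat_mul]
  push_cast
  ring_nf

end Examples

theorem mainTheorem1 (h : ℝ) :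
    -- the general statement
    (∀ g g' : ℕ → ℝ, CoeffDecay g g' →
      -- `γ_c` is the largest coupling for which the full-support density is nonnegative
      (∀ γ : ℝ, 0 ≤ γ → (ENNReal.ofReal γ ≤ criticalCoupling g g' ↔
        ∀ φ ∈ Set.Ioc (-Real.pi) Real.pi, 0 ≤ fullDensity g g' γ φ)) ∧
      Summable (fun n : ℕ => (g (n + 1) ^ 2 + g' (n + 1) ^ 2) / ((n : ℝ) + 1)) ∧
      -- the limit of the free energy
      (∀ γ : ℝ, 0 ≤ γ → ENNReal.ofReal γ ≤ criticalCoupling g g' →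
        Tendsto (fun N : ℕ => freeEnergy N (potential h g g') γ) atTop
          (𝓝 (γ * h + γ ^ 2 *
            ∑' n : ℕ, (g (n + 1) ^ 2 + g' (n + 1) ^ 2) / ((n : ℝ) + 1)))) ∧
      -- the limit is the value of the Szegő exponent at `β = γ N`, divided by `N ^ 2`
      (∀ γ : ℝ, ∀ N : ℕ, 1 ≤ N →
        szegoExponent N (potential h g g') (γ * N) / (N : ℂ) ^ 2 =
          ((γ * h + γ ^ 2 *
            ∑' n : ℕ, (g (n + 1) ^ 2 + g' (n + 1) ^ 2) / ((n : ℝ) + 1) : ℝ) : ℂ))) ∧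
    -- exponentially decaying interaction
    (∀ α : ℝ, 0 < α → ∀ γ : ℝ, 0 ≤ γ →
      ENNReal.ofReal γ ≤ criticalCoupling (fun n => Real.exp (-(n * α))) (fun _ => 0) →
        Tendsto (fun N : ℕ =>
            freeEnergy N (potential h (fun n => Real.exp (-(n * α))) (fun _ => 0)) γ) atTop
          (𝓝 (γ * h - γ ^ 2 * Real.log (1 - Real.exp (-(2 * α)))))) ∧
    -- polylogarithmic interaction
    (∀ p : ℤ, ∀ α : ℝ, (0 < α ∨ (α = 0 ∧ 0 < p)) → ∀ γ : ℝ, 0 ≤ γ →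
      ENNReal.ofReal γ ≤
          criticalCoupling (fun n => Real.exp (-(n * α)) / (n : ℝ) ^ p) (fun _ => 0) →
        Tendsto (fun N : ℕ => freeEnergy N
            (potential h (fun n => Real.exp (-(n * α)) / (n : ℝ) ^ p) (fun _ => 0)) γ) atTop
          (𝓝 (γ * h + γ ^ 2 *
            ∑' n : ℕ, Real.exp (-(2 * ((n : ℝ) + 1) * α)) / ((n : ℝ) + 1) ^ (2 * p + 1)))) := by

  refine ⟨fun g g' hd => ?_, fun α hα γ hγ hγc => ?_, fun p α hα γ hγ hγc =>
    tendsto_freeEnergy_exp_div_zpow h hα hγ hγc⟩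
  · obtain ⟨hs, B, hg, hg'⟩ := hd.summableCoeff
    exact ⟨fun γ hγ => ofReal_le_criticalCoupling_iff_fullDensity hγ, hs.summable_sq hg hg',
      fun γ hγ hγc => hd.tendsto_freeEnergy h hγ hγc, fun γ N hN => hs.szegoExponent_eq h γ hN⟩
  -- The exponential interaction is the case p = 0, where the series sums to a logarithm.
  · have e : (fun n : ℕ => Real.exp (-(n * α)))
        = fun n : ℕ => Real.exp (-(n * α)) / (n : ℝ) ^ (0 : ℤ) := by
      funext n; simp
    rw [e] at hγc ⊢
    have h1 := tendsto_freeEnergy_exp_div_zpow h (Or.inl hα) hγ hγc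
    simp only [mul_zero, zero_add, zpow_one, tsum_exp_div hα] at h1
    rwa [mul_neg, ← sub_eq_add_neg] at h1
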